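/- Let $G$ be a finite connected plane graph (loops and parallel edges allowed), each of whose edges consists of two oppositely directed darts $d,\operatorname{rev}(d)$, with capacities $c[d]\ge 0$ on the darts. Let $s_1,t_1,s_2,t_2,\dots,s_m,t_m$ be distinct vertices occurring in this clockwise order on the boundary $\partial G$ of the infinite face; the $s_i$ are the sources and the $t_i$ the sinks. A flow w.r.t. capacities $c$ is an antisymmetric real function $f\le c$ on the darts that is balanced at all non-terminal vertices; its value is the net flow entering the sinks; the residual capacities are $c-f$; a path or cycle is residual w.r.t. given capacities if all its darts have strictly positive capacity. For an $st$-flow the only terminals are $s$ and $t$. A maximum $st$-flow $f$ w.r.t. $c$ is leftmost if no clockwise simple cycle is residual w.r.t. $c-f$. Consider the following algorithm. First saturate all $s_j$-to-$t_i$ residual paths with $i<j$ and all clockwise cycles: by subtracting a flow (with all $s_i,t_i$ as terminals), pass from $c$ to residual capacities $c_0$ w.r.t. which no $s_j$-to-$t_i$ path with $i<j$ and no clockwise simple cycle is residual. Then, for $j=1,\dots,m$ and, for each $j$, for $i=j,j-1,\dots,1$, perform iteration $(i,j)$: if $c'_{ij}$ are the current capacities, find a leftmost maximum $s_it_j$-flow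 $f_{ij}$ w.r.t. $c'_{ij}$ and pass to the residual capacities $c_{ij}=c'_{ij}-f_{ij}$. Fix an iteration $(i,j)$ and a decomposition of $f_{ij}$ into non-crossing simple $s_i$-to-$t_j$ paths $P_1,\dots,P_\ell$, $\ell\ge 1$, where $P_r$ carries a positive amount of flow in the direction of $f_{ij}$ and $P_q$ is left of $P_r$ (i.e. $P_q\circ\operatorname{rev}(P_r)$ is clockwise) for $q<r$. Let $P=P_\ell$ be the rightmost path. Then: 1. For every $k>i$, no path from $s_k$ to a vertex of $P$ (the trivial path included) is residual w.r.t. $c_{ij}$. 2. Everything strictly left of $P$ can be deleted at the end of iteration $(i,j)$ without affecting optimality. Precisely, let $X$ be any set of darts not on $P$ in either direction whose edges are left of $P$, i.e. lie inside the clockwise cycle $\partial G[s_i,t_j]\circ\operatorname{rev}(P)$ or on $\partial G[s_i,t_j]$, where $\partial G[s_i,t_j]$ is the clockwise boundary from $s_i$ to $t_j$ ($X$ may consist of all such darts). Let $\hat c_{ij}$ be obtained from $c_{ij}$ by setting the capacities of the darts in $X$ to $0$. Then (a) for every flow $g$ w.r.t. $c_{ij}$ with terminals $s_1,t_1,\dots,s_m,t_m$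 there is such a flow $g'$ w.r.t. $\hat c_{ij}$ whose value is at least that of $g$, so the maximum value is unchanged; (b) whenever the iterations that follow $(i,j)$ are performed starting from $\hat c_{ij}$ instead of $c_{ij}$, with final capacities $c_{\mathrm{end}}$, the total flow $(c-c_{ij})+(\hat c_{ij}-c_{\mathrm{end}})$ is a maximum flow from $\{s_1,\dots,s_m\}$ to $\{t_1,\dots,t_m\}$ in $G$ w.r.t. the original capacities $c$. -/

import Mathlib

/-- A connected plane graph (loops and parallel edges allowed), given by its rotation system.
Every edge consists of two mutually reverse darts, and `rot d` is the next dart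
in clockwise order around the tail of `d`. -/
structure PlaneGraph (D : Type*) [Fintype D] where
  rev : Equiv.Perm D
  rev_rev : ∀ d, rev (rev d) = d
  rev_ne : ∀ d, rev d ≠ d
  rot : Equiv.Perm D
  connected : ∀ d e : D, Relation.ReflTransGen (fun a b => b = rot a ∨ b = rev a) d e
  /-- Euler's formula `V - E + F = 2`, doubled, with `2 E` the number of darts. -/
  euler : 2 * (Nat.card (Quotient (Equiv.Perm.SameCycle.setoid rot)) +
      Nat.card (Quotient (Equiv.Perm.SameCycle.setoid (rot * rev)))) = Fintype.card D + 4

namespace PlaneGraph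

section

variable {D : Type*} [Fintype D] (G : PlaneGraph D)

/-- Vertices are the orbits of darts under rotation around the tail. -/
abbrev Vertex : Type _ := Quotient (Equiv.Perm.SameCycle.setoid G.rot)

/-- The next dart along the boundary of the face on the left of a dart. -/
abbrev facePerm : Equiv.Perm D := G.rot * G.rev

/-- Faces are the orbits of `facePerm`; the orbit of `d` is the face on the left of `d`. -/
abbrev Face : Type _ := Quotient (Equiv.Perm.SameCycle.setoid G.facePerm)

def tail (d : D) : G.Vertex := Quotient.mk _ d

def head (d : D) : G.Vertex := G.tail (G.rev d)

def left (d : D) : G.Face := Quotient.mk _ d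

def right (d : D) : G.Face := G.left (G.rev d)

/-- `G.IsPath u p v`: the sequence of darts `p` is a path from `u` to `v`
(vertices may repeat, and the trivial path is allowed). -/
def IsPath : G.Vertex → List D → G.Vertex → Prop
  | u, [], v => u = v
  | u, d :: p, v => G.tail d = u ∧ IsPath (G.head d) p v

def IsSimplePath (u : G.Vertex) (p : List D) (v : G.Vertex) : Prop :=
  G.IsPath u p v ∧ (u :: p.map G.head).Nodup

def IsSimpleCycle (C : List D) : Prop :=
  C ≠ [] ∧ (∃ u, G.IsPath u C u) ∧ (C.map G.head).Nodup

/-- The vertices lying on a nontrivial path. -/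
def OnPath (p : List D) (v : G.Vertex) : Prop :=
  ∃ d ∈ p, v = G.tail d ∨ v = G.head d

def revPath (p : List D) : List D := (p.map G.rev).reverse

/-- Every dart of `p` has strictly positive capacity. -/
def Residual (c : D → ℝ) (p : List D) : Prop := ∀ d ∈ p, 0 < c d

section

variable [DecidableEq D]

/-- `w` assigns to every face the clockwise winding number around it of the closed sequence of
darts `C`: it is `0` at the infinite face, and crossing a dart of `C` from left to right
increases it by one. -/
def IsWinding (inf : G.Face) (C : List D) (w : G.Face → ℤ) : Prop :=
  w inf = 0 ∧ ∀ d, w (G.right d) - w (G.left d) = (C.count d : ℤ) - C.count (G.rev d)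

/-- A closed sequence of darts is clockwise if it winds around no face counterclockwise and around
at least one face clockwise. For a simple cycle: the enclosed faces are on its right. -/
def IsClockwise (inf : G.Face) (C : List D) : Prop :=
  ∃ w, G.IsWinding inf C w ∧ (∀ x, 0 ≤ w x) ∧ ∃ x, 0 < w x

/-- For simple paths `P`, `Q` with common ends, both on the boundary of the infinite face:
`P` and `Q` do not cross, and `P` is left of `Q`, i.e. `P ∘ rev Q` is clockwise. (If `P` and `Q`
cross, `P ∘ rev Q` winds clockwise around some face and counterclockwise around another.) -/
def LeftOf (inf : G.Face) (P Q : List D) : Prop :=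
  G.IsClockwise inf (P ++ G.revPath Q)

end

def residualCap (c f : D → ℝ) : D → ℝ := fun d => c d - f d

open Classical in
/-- A flow with respect to capacities `c` and the set of terminals `T`. -/
def IsFlow (c : D → ℝ) (T : Set G.Vertex) (f : D → ℝ) : Prop :=
  (∀ d, f (G.rev d) = - f d) ∧ (∀ d, f d ≤ c d) ∧
    ∀ v, v ∉ T → ∑ d, (if G.tail d = v then f d else 0) = 0

open Classical in
/-- The net flow entering the set of sinks `T`. -/
noncomputable def flowValue (T : Set G.Vertex) (f : D → ℝ) : ℝ :=
  ∑ d, if G.head d ∈ T then f d else 0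

/-- A maximum flow from the set of sources `S` to the set of sinks `T`. -/
def IsMaxFlow (c : D → ℝ) (S T : Set G.Vertex) (f : D → ℝ) : Prop :=
  G.IsFlow c (S ∪ T) f ∧ ∀ g, G.IsFlow c (S ∪ T) g → G.flowValue T g ≤ G.flowValue T f

open Classical in
/-- Deleting a set of darts: their capacities become zero. -/
noncomputable def deleteCap (c : D → ℝ) (X : Set D) : D → ℝ := fun d => if d ∈ X then 0 else c d

section

variable [DecidableEq D]

/-- The capacities are clockwise acyclic: no clockwise simple cycle is residual. -/
def CwAcyclic (inf : G.Face) (c : D → ℝ) : Prop :=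
  ∀ C, G.IsSimpleCycle C → G.IsClockwise inf C → ¬ Residual c C

/-- A leftmost maximum `st`-flow. -/
def IsLeftmostMaxFlow (inf : G.Face) (c : D → ℝ) (s t : G.Vertex) (f : D → ℝ) : Prop :=
  G.IsMaxFlow c {s} {t} f ∧ G.CwAcyclic inf (residualCap c f)

open Classical in
/-- `Ps` lists a decomposition of the `st`-flow `f` into non-crossing simple `s`-to-`t` paths
from left to right, each with the positive amount of flow that it carries. -/
structure IsPathDecomposition (inf : G.Face) (s t : G.Vertex) (f : D → ℝ)
    (Ps : List (List D × ℝ)) : Prop where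
  simple : ∀ p ∈ Ps, G.IsSimplePath s p.1 t
  pos : ∀ p ∈ Ps, 0 < p.2
  sum : ∀ d, max (f d) 0 = (Ps.map fun p => if d ∈ p.1 then p.2 else 0).sum
  ordered : Ps.Pairwise fun p q => G.LeftOf inf p.1 q.1

end

/-- Sources and sinks `s_0, t_0, s_1, t_1, …, s_{m-1}, t_{m-1}`, pairwise distinct vertices that
occur in this clockwise order on the boundary of the infinite face. The boundary is traversed
clockwise by iterating `facePerm` from `base`; `posS i` and `posT i` are the positions on this
closed walk of the occurrences of the terminals. -/
structure Terminals (m : ℕ) where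
  base : D
  posS : Fin m → ℕ
  posT : Fin m → ℕ
  posS_lt_posT : ∀ i, posS i < posT i
  posT_lt_posS : ∀ i j, i < j → posT i < posS j
  posT_lt : ∀ i, posT i < Function.minimalPeriod G.facePerm base
  distinct : Function.Injective (Sum.elim
    (fun i => G.tail (G.facePerm^[posS i] base)) (fun i => G.tail (G.facePerm^[posT i] base)))

namespace Terminals

variable {G} {m : ℕ} (T : G.Terminals m)

/-- The infinite face. -/
def inf : G.Face := G.left T.base

def s (i : Fin m) : G.Vertex := G.tail (G.facePerm^[T.posS i] T.base)

def t (i : Fin m) : G.Vertex := G.tail (G.facePerm^[T.posT i] T.base)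

/-- The part of the clockwise boundary from `s_i` to `t_j`, for `i ≤ j`. -/
def arc (i j : Fin m) : List D :=
  (List.range' (T.posS i) (T.posT j - T.posS i)).map fun k => G.facePerm^[k] T.base

section

variable [DecidableEq D]

/-- `x` is enclosed by the cycle formed by the clockwise boundary from `s_i` to `t_j` and the
reverse of `P`. -/
def FaceLeftOf (i j : Fin m) (P : List D) (x : G.Face) : Prop :=
  ∃ w, G.IsWinding T.inf (T.arc i j ++ G.revPath P) w ∧ 0 < w x

/-- The edge of `d` is left of the `s_i`-to-`t_j` path `P` and not on `P`: it is incident to a face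
left of `P` or lies on the clockwise boundary from `s_i` to `t_j`, and it is not an edge of `P`. -/
def StrictlyLeftOf (i j : Fin m) (P : List D) (d : D) : Prop :=
  (T.FaceLeftOf i j P (G.left d) ∨ T.FaceLeftOf i j P (G.right d) ∨
    d ∈ T.arc i j ∨ G.rev d ∈ T.arc i j) ∧ d ∉ P ∧ G.rev d ∉ P

/-- `c₀` can result from `c` by the first step of the algorithm: saturating all `s_j`-to-`t_i`
residual paths with `i < j` and all clockwise cycles. -/
def Preprocessed (c c₀ : D → ℝ) : Prop :=
  (∃ f, G.IsFlow c (Set.range T.s ∪ Set.range T.t) f ∧ c₀ = residualCap c f) ∧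
  (∀ i j, i < j → ∀ p, G.IsPath (T.s j) p (T.t i) → ¬ Residual c₀ p) ∧
  G.CwAcyclic T.inf c₀

/-- `T.Run L c c'`: `c'` can result from the capacities `c` by processing the pairs `(i, j)` of the
list `L` in order, each time finding a leftmost maximum `s_i t_j`-flow with respect to the current
capacities and passing to the residual capacities. -/
inductive Run : List (Fin m × Fin m) → (D → ℝ) → (D → ℝ) → Prop
  | nil (c : D → ℝ) : Run [] c c
  | cons {i j : Fin m} {L : List (Fin m × Fin m)} {c f c' : D → ℝ}
      (hf : G.IsLeftmostMaxFlow T.inf c (T.s i) (T.t j) f)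
      (h : Run L (residualCap c f) c') : Run ((i, j) :: L) c c'

end

end Terminals

end

end PlaneGraph

/-- The iterations `(i, j)` in the order in which the algorithm performs them:
`j = 0, 1, …, m - 1`, and for each `j`, `i = j, j - 1, …, 0`. -/
def iterations (m : ℕ) : List (Fin m × Fin m) :=
  (List.finRange m).flatMap fun j =>
    (((List.finRange m).filter fun i => i ≤ j).reverse).map fun i => (i, j)

/-! Three ingredients are combined: cut arguments on residually closed vertex sets, winding numbers
in place of the Jordan curve theorem, and flow decomposition.

The invariant of the algorithm is that $s_k$ is separated from $t_l$ by a residually closed set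
whenever $l<k$ or $(k,l)$ has been processed. A maximum $st$-flow keeps a closed set closed unless
the set contains $t$ and not $s$. By intersecting or uniting two available closed sets, this
exception is avoided in every iteration (`BlockedPairs.step`); no planarity is needed here. For
$k>i$ the pair $(k,j)$ is blocked before iteration $(i,j)$, and $P$ leads residually to $t_j$, so
the separating set misses $P$ and stays closed. This is claim 1.

For claim 2, let $Z$ be a simple residual path from $s_k$ to $t_l$ after the iteration. By the
invariant its pair is not blocked. If $k\le i$, then $l\ge j$, and a face left of $P$ but not left
of $Z$ would give a clockwise residual cycle made of darts of $Z$ and reversed darts of $P$, against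
leftmostness; so $Z$ never enters the part strictly left of $P$ (`not_strictlyLeftOf_of_source_le`).
If $k>i$, then $l>j$ and $Z$ avoids $P$ by claim 1; a path off $P$ cannot pass from the left part to
$t_l$ (`not_strictlyLeftOf_of_avoids`). Hence $X$ lies on no residual source-to-sink path, and flow
decomposition gives (a). Deletion only lowers capacities, so the invariant survives it; after the
last iteration every pair is blocked, and with (a) this gives (b).

Planarity enters through `exists_potential`: by Euler's formula every circulation is the coboundary
of a face potential, which makes winding numbers exist. -/

namespace PlaneGraph

section

variable {D : Type*} [Fintype D] (G : PlaneGraph D)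

/-! ### Incidence -/

@[simp] theorem rev_rev_apply (d : D) : G.rev (G.rev d) = d := G.rev_rev d

@[simp] theorem head_rev (d : D) : G.head (G.rev d) = G.tail d := by simp [head]

@[simp] theorem tail_rev (d : D) : G.tail (G.rev d) = G.head d := rfl

@[simp] theorem left_rev (d : D) : G.left (G.rev d) = G.right d := rfl

@[simp] theorem right_rev (d : D) : G.right (G.rev d) = G.left d := by simp [right]

@[simp] theorem tail_rot (d : D) : G.tail (G.rot d) = G.tail d :=
  Quotient.sound (Equiv.Perm.sameCycle_apply_left.2 (Equiv.Perm.SameCycle.refl _ _))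

@[simp] theorem left_facePerm (d : D) : G.left (G.facePerm d) = G.left d :=
  Quotient.sound (Equiv.Perm.sameCycle_apply_left.2 (Equiv.Perm.SameCycle.refl _ _))

theorem facePerm_rev (d : D) : G.facePerm (G.rev d) = G.rot d := by
  simp [facePerm]

@[simp] theorem left_rot (d : D) : G.left (G.rot d) = G.right d := by
  rw [← facePerm_rev, left_facePerm, left_rev]

@[simp] theorem tail_facePerm (d : D) : G.tail (G.facePerm d) = G.head d := by
  simp [facePerm]

theorem rev_eq_iff {d e : D} : G.rev d = e ↔ d = G.rev e :=
  ⟨fun h => by simp [← h], fun h => by simp [h]⟩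

/-- Both `rot` and `rev` take a dart to one whose left face is the old right face, so connectivity
of the darts yields connectivity of the dual graph. -/
theorem face_induction {S : G.Face → Prop} (h : ∀ d, S (G.left d) → S (G.right d))
    {x : G.Face} (hx : S x) (y : G.Face) : S y := by
  obtain ⟨a, rfl⟩ := Quotient.exists_rep x
  obtain ⟨b, rfl⟩ := Quotient.exists_rep y
  change S (G.left a) at hx
  change S (G.left b)
  induction G.connected a b with
  | refl => exact hx
  | tail _ hbc ih =>
    rcases hbc with rfl | rfl
    · rw [left_rot]; exact h _ ih
    · exact h _ ih

theorem vertex_induction {S : G.Vertex → Prop} (h : ∀ d, S (G.tail d) → S (G.head d))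
    {x : G.Vertex} (hx : S x) (y : G.Vertex) : S y := by
  obtain ⟨a, rfl⟩ := Quotient.exists_rep x
  obtain ⟨b, rfl⟩ := Quotient.exists_rep y
  change S (G.tail a) at hx
  change S (G.tail b)
  induction G.connected a b with
  | refl => exact hx
  | tail _ hbc ih =>
    rcases hbc with rfl | rfl
    · rwa [tail_rot]
    · exact h _ ih

/-! ### Net outflow of a set of vertices -/

theorem sum_eq_zero_of_antisymm {f : D → ℝ} (hf : ∀ d, f (G.rev d) = - f d) : ∑ d, f d = 0 := by
  have h := Equiv.sum_comp G.rev f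
  simp only [hf, Finset.sum_neg_distrib] at h
  linarith

open Classical in
/-- The net flow leaving a set of vertices. -/
noncomputable def outflow (A : Set G.Vertex) : (D → ℝ) →ₗ[ℝ] ℝ where
  toFun f := ∑ d, if G.tail d ∈ A then f d else 0
  map_add' f g := by
    rw [← Finset.sum_add_distrib]
    exact Finset.sum_congr rfl fun d _ => by split_ifs <;> simp
  map_smul' a f := by
    rw [RingHom.id_apply, smul_eq_mul, Finset.mul_sum]
    exact Finset.sum_congr rfl fun d _ => by split_ifs <;> simp

open Classical in
theorem outflow_apply (A : Set G.Vertex) (f : D → ℝ) :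
    G.outflow A f = ∑ d, if G.tail d ∈ A then f d else 0 := rfl

theorem isFlow_iff {c : D → ℝ} {T : Set G.Vertex} {f : D → ℝ} :
    G.IsFlow c T f ↔ (∀ d, f (G.rev d) = - f d) ∧ (∀ d, f d ≤ c d) ∧
      ∀ v, v ∉ T → G.outflow {v} f = 0 := by
  refine and_congr Iff.rfl (and_congr Iff.rfl (forall₂_congr fun v _ => ?_))
  rw [outflow_apply]
  exact Eq.congr_left (Finset.sum_congr rfl fun d _ => by congr)

theorem flowValue_eq {f : D → ℝ} (hf : ∀ d, f (G.rev d) = - f d) (T : Set G.Vertex) :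
    G.flowValue T f = - G.outflow T f := by
  classical
  rw [outflow_apply, flowValue, ← Equiv.sum_comp G.rev, ← Finset.sum_neg_distrib]
  refine Finset.sum_congr rfl fun d _ => ?_
  rw [head_rev, hf]
  split_ifs <;> simp

/-- Grouping the darts by tail turns the sum into the pairing of `p` with the divergence of `f`. -/
theorem sum_mul_tail_eq_zero {f : D → ℝ} {p : G.Vertex → ℝ}
    (h : ∀ v, p v = 0 ∨ G.outflow {v} f = 0) : ∑ d, f d * p (G.tail d) = 0 := by
  classical
  let : Fintype G.Vertex := Fintype.ofFinite _
  have h1 : ∑ d, f d * p (G.tail d) = ∑ v, p v * G.outflow {v} f := by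
    simp only [outflow_apply, Finset.mul_sum, Set.mem_singleton_iff]
    rw [Finset.sum_comm]
    refine Finset.sum_congr rfl fun d _ => ?_
    rw [Finset.sum_eq_single (G.tail d)]
    · simp [mul_comm]
    · intro v _ hv
      simp [Ne.symm hv]
    · simp
  rw [h1]
  exact Finset.sum_eq_zero fun v _ => by rcases h v with h | h <;> simp [h]

/-- Balanced vertices contribute nothing, so the outflow of a set depends only on the terminals in
it. -/
theorem outflow_congr {f : D → ℝ} {T A B : Set G.Vertex} (hf : ∀ v, v ∉ T → G.outflow {v} f = 0)
    (h : ∀ v ∈ T, v ∈ A ↔ v ∈ B) : G.outflow A f = G.outflow B f := by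
  classical
  have := G.sum_mul_tail_eq_zero (f := f)
    (p := fun v => (if v ∈ A then 1 else 0) - (if v ∈ B then 1 else 0)) fun v => by
      by_cases hv : v ∈ T
      · left; simp [h v hv]
      · exact Or.inr (hf v hv)
  simp only [mul_sub, Finset.sum_sub_distrib, mul_ite, mul_one, mul_zero] at this
  rw [outflow_apply, outflow_apply]
  linarith

theorem outflow_univ {f : D → ℝ} (hf : ∀ d, f (G.rev d) = - f d) : G.outflow Set.univ f = 0 := by
  simpa [outflow_apply] using G.sum_eq_zero_of_antisymm hf

theorem outflow_empty (f : D → ℝ) : G.outflow ∅ f = 0 := by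
  simp [outflow_apply]

theorem outflow_union {A B : Set G.Vertex} (h : Disjoint A B) (f : D → ℝ) :
    G.outflow (A ∪ B) f = G.outflow A f + G.outflow B f := by
  classical
  rw [outflow_apply, outflow_apply, outflow_apply, ← Finset.sum_add_distrib]
  refine Finset.sum_congr rfl fun d _ => ?_
  by_cases h1 : G.tail d ∈ A
  · simp [h1, Set.disjoint_left.1 h h1]
  · simp [h1]

open Classical in
/-- The net outflow of a set of vertices passes through the darts that leave it. -/
theorem outflow_eq_sum_leaving {f : D → ℝ} (hf : ∀ d, f (G.rev d) = - f d) (A : Set G.Vertex) :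
    G.outflow A f = ∑ d, if G.tail d ∈ A ∧ G.head d ∉ A then f d else 0 := by
  have h := G.sum_eq_zero_of_antisymm
    (f := fun d => if G.tail d ∈ A ∧ G.head d ∈ A then f d else 0) fun d => by
      simp only [tail_rev, head_rev, hf, and_comm]
      split_ifs <;> simp
  rw [outflow_apply, ← sub_eq_zero, ← Finset.sum_sub_distrib]
  refine Eq.trans ?_ h
  refine Finset.sum_congr rfl fun d _ => ?_
  by_cases h1 : G.tail d ∈ A <;> by_cases h2 : G.head d ∈ A <;> simp [h1, h2]

/-! ### Circulations are coboundaries of face potentials -/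

/-- The antisymmetric functions on darts. -/
def antisymm : Submodule ℝ (D → ℝ) where
  carrier := {f | ∀ d, f (G.rev d) = - f d}
  add_mem' {f g} hf hg d := by simp only [Pi.add_apply, hf d, hg d]; ring
  zero_mem' d := by simp
  smul_mem' a f hf d := by simp [hf d]

/-- The symmetric functions on darts. -/
def symm : Submodule ℝ (D → ℝ) where
  carrier := {f | ∀ d, f (G.rev d) = f d}
  add_mem' {f g} hf hg d := by simp only [Pi.add_apply, hf d, hg d]
  zero_mem' d := by simp
  smul_mem' a f hf d := by simp [hf d]

/-- Symmetric and antisymmetric functions are complementary, and multiplication by the signs `ε` of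
an orientation of the edges exchanges them; so each has half the dimension. -/
theorem two_mul_finrank_antisymm : 2 * Module.finrank ℝ G.antisymm = Fintype.card D := by
  classical
  obtain ⟨ε, hε, hε1⟩ : ∃ ε : D → ℝ, (∀ d, ε (G.rev d) = - ε d) ∧ ∀ d, ε d * ε d = 1 := by
    let n := Fintype.equivFin D
    refine ⟨fun d => if n d < n (G.rev d) then 1 else -1, fun d => ?_, fun d => ?_⟩
    · have h : n (G.rev d) ≠ n d := fun h => G.rev_ne d (n.injective h)
      simp only [rev_rev_apply]
      rcases lt_or_gt_of_ne h with h | h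
      · simp [h, not_lt.2 h.le]
      · simp [h, not_lt.2 h.le]
    · dsimp only
      split_ifs <;> norm_num
  let e : G.symm ≃ₗ[ℝ] G.antisymm :=
    { toFun := fun f => ⟨fun d => ε d * f.1 d, fun d => by simp [hε, f.2 d]⟩
      invFun := fun f => ⟨fun d => ε d * f.1 d, fun d => by simp [hε, f.2 d]⟩
      map_add' := fun f g => by ext d; simp [mul_add]
      map_smul' := fun a f => by ext d; simp; ring
      left_inv := fun f => by ext d; simp [← mul_assoc, hε1]
      right_inv := fun f => by ext d; simp [← mul_assoc, hε1] }
  have hcompl : IsCompl G.symm G.antisymm := by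
    constructor
    · rw [Submodule.disjoint_def]
      intro f h1 h2
      ext d
      have h1 := h1 d
      have h2 := h2 d
      simp only [Pi.zero_apply]
      linarith
    · rw [codisjoint_iff, eq_top_iff]
      intro f _
      refine Submodule.mem_sup.2 ⟨fun d => (f d + f (G.rev d)) / 2, fun d => ?_,
        fun d => (f d - f (G.rev d)) / 2, fun d => ?_, ?_⟩
      · simp only [rev_rev_apply]; ring
      · simp only [rev_rev_apply]; ring
      · ext d; simp only [Pi.add_apply]; ring
  have h1 := Submodule.finrank_add_eq_of_isCompl hcompl
  rw [e.finrank_eq, Module.finrank_fintype_fun_eq_card] at h1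
  omega

/-- The divergence of a function on darts at the vertices. -/
noncomputable def divergence : (D → ℝ) →ₗ[ℝ] (G.Vertex → ℝ) :=
  LinearMap.pi fun v => G.outflow {v}

/-- The coboundary of a face potential. -/
def faceDiff : (G.Face → ℝ) →ₗ[ℝ] (D → ℝ) where
  toFun φ d := φ (G.right d) - φ (G.left d)
  map_add' φ ψ := by ext d; simp; ring
  map_smul' a φ := by ext d; simp; ring

theorem faceDiff_apply (φ : G.Face → ℝ) (d : D) :
    G.faceDiff φ d = φ (G.right d) - φ (G.left d) := rfl

theorem faceDiff_rev (φ : G.Face → ℝ) (d : D) : G.faceDiff φ (G.rev d) = - G.faceDiff φ d := by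
  simp [faceDiff_apply]

/-- Around a vertex the right face of each dart is the left face of the next one, so the differences
telescope. -/
theorem outflow_faceDiff (φ : G.Face → ℝ) (A : Set G.Vertex) :
    G.outflow A (G.faceDiff φ) = 0 := by
  classical
  have h := Equiv.sum_comp G.rot fun d => if G.tail d ∈ A then φ (G.left d) else 0
  simp only [tail_rot, left_rot] at h
  refine Eq.trans ?_ (sub_eq_zero.2 h)
  rw [outflow_apply, ← Finset.sum_sub_distrib]
  refine Finset.sum_congr rfl fun d _ => ?_
  split_ifs <;> simp [faceDiff_apply]

/-- A unit of flow on one edge has divergence $\delta_{tail}-\delta_{head}$. By connectivity the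
image contains all $\delta_u-\delta_v$, and one further vector $\delta_u$ makes it everything. -/
theorem card_vertex_le_finrank_divergence :
    Nat.card G.Vertex ≤ Module.finrank ℝ (G.antisymm.map G.divergence) + 1 := by
  classical
  let : Fintype G.Vertex := Fintype.ofFinite _
  by_cases hne : IsEmpty G.Vertex
  · simp
  rw [not_isEmpty_iff] at hne
  obtain ⟨u⟩ := hne
  set R := G.antisymm.map G.divergence with hR
  have hstep : ∀ d, (Pi.single (G.tail d) 1 - Pi.single (G.head d) 1 : G.Vertex → ℝ) ∈ R := by
    intro d
    refine ⟨Pi.single d 1 - Pi.single (G.rev d) 1, fun e => ?_, ?_⟩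
    · simp only [Pi.sub_apply, Pi.single_apply, rev_eq_iff, rev_rev_apply]
      ring
    · ext v
      simp only [divergence, LinearMap.pi_apply, map_sub, outflow_apply, Pi.single_apply,
        Set.mem_singleton_iff, Pi.sub_apply]
      congr 1
      · rw [Finset.sum_eq_single d] <;> simp +contextual [eq_comm]
      · rw [Finset.sum_eq_single (G.rev d)] <;> simp +contextual [eq_comm]
  have hall : ∀ v, (Pi.single u 1 - Pi.single v 1 : G.Vertex → ℝ) ∈ R := by
    refine G.vertex_induction (x := u) (fun d h => ?_) (by simp)
    simpa using R.add_mem h (hstep d)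
  have htop : R ⊔ Submodule.span ℝ {(Pi.single u 1 : G.Vertex → ℝ)} = ⊤ := by
    rw [eq_top_iff, ← (Pi.basisFun ℝ G.Vertex).span_eq, Submodule.span_le]
    rintro _ ⟨v, rfl⟩
    rw [Pi.basisFun_apply]
    refine Submodule.mem_sup.2 ⟨_, R.neg_mem (hall v), Pi.single u 1,
      Submodule.mem_span_singleton_self _, by simp⟩
  have h1 := Submodule.finrank_add_le_finrank_add_finrank R
    (Submodule.span ℝ {(Pi.single u 1 : G.Vertex → ℝ)})
  rw [htop, finrank_top, Module.finrank_fintype_fun_eq_card] at h1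
  have h2 := finrank_span_le_card (R := ℝ) ({(Pi.single u 1 : G.Vertex → ℝ)} : Set (G.Vertex → ℝ))
  simp only [Set.toFinset_singleton, Finset.card_singleton] at h2
  rw [Nat.card_eq_fintype_card]
  omega

/-- A potential with zero coboundary is constant, since the dual graph is connected; so the kernel
has dimension at most one. -/
theorem card_face_le_finrank_faceDiff :
    Nat.card G.Face ≤ Module.finrank ℝ (LinearMap.range G.faceDiff) + 1 := by
  classical
  let : Fintype G.Face := Fintype.ofFinite _
  have hker : LinearMap.ker G.faceDiff ≤ Submodule.span ℝ {(fun _ => 1 : G.Face → ℝ)} := by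
    intro φ hφ
    rcases isEmpty_or_nonempty G.Face with he | ⟨⟨x⟩⟩
    · have : φ = 0 := Subsingleton.elim _ _
      simp [this]
    refine Submodule.mem_span_singleton.2 ⟨φ x, ?_⟩
    ext y
    simp only [Pi.smul_apply, smul_eq_mul, mul_one]
    refine G.face_induction (S := fun y => φ x = φ y) (x := x) (fun d h => ?_) rfl y
    have := congrFun (LinearMap.mem_ker.1 hφ) d
    rw [faceDiff_apply, Pi.zero_apply] at this
    linarith
  have h1 := LinearMap.finrank_range_add_finrank_ker G.faceDiff
  rw [Module.finrank_fintype_fun_eq_card] at h1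
  have h2 := finrank_span_le_card (R := ℝ) ({(fun _ => 1 : G.Face → ℝ)} : Set (G.Face → ℝ))
  simp only [Set.toFinset_singleton, Finset.card_singleton] at h2
  have h3 := Submodule.finrank_mono hker
  rw [Nat.card_eq_fintype_card]
  omega

/-- Dimension count: the circulations have dimension at most $E-(V-1)$, the coboundaries lie among
them and have dimension at least $F-1$, and Euler's formula says that these numbers agree. -/
theorem exists_potential {f : D → ℝ} (hf : ∀ d, f (G.rev d) = - f d)
    (hbal : ∀ v, G.outflow {v} f = 0) :
    ∃ φ : G.Face → ℝ, ∀ d, f d = φ (G.right d) - φ (G.left d) := by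
  classical
  let : Fintype G.Vertex := Fintype.ofFinite _
  set K := G.antisymm ⊓ LinearMap.ker G.divergence with hK
  have hle : LinearMap.range G.faceDiff ≤ K := by
    rintro _ ⟨φ, rfl⟩
    refine ⟨G.faceDiff_rev φ, LinearMap.mem_ker.2 ?_⟩
    ext v
    exact G.outflow_faceDiff φ {v}
  have h1 := LinearMap.finrank_range_add_finrank_ker (G.divergence.domRestrict G.antisymm)
  rw [LinearMap.range_domRestrict, LinearMap.ker_domRestrict] at h1
  have h2 := Submodule.finrank_map_subtype_eq G.antisymm
    ((LinearMap.ker G.divergence).comap G.antisymm.subtype)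
  rw [Submodule.map_comap_subtype, ← hK] at h2
  have h3 := G.two_mul_finrank_antisymm
  have h4 := G.card_vertex_le_finrank_divergence
  have h5 := G.card_face_le_finrank_faceDiff
  have h6 := G.euler
  change 2 * (Nat.card G.Vertex + Nat.card G.Face) = _ at h6
  have heq : LinearMap.range G.faceDiff = K := Submodule.eq_of_le_of_finrank_le hle (by omega)
  have hmem : f ∈ K := ⟨hf, LinearMap.mem_ker.2 (by ext v; exact hbal v)⟩
  rw [← heq] at hmem
  obtain ⟨φ, rfl⟩ := hmem
  exact ⟨φ, fun d => rfl⟩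

end

end PlaneGraph

namespace PlaneGraph

section

variable {D : Type*} [Fintype D] {G : PlaneGraph D}

/-! ### Paths -/

theorem IsPath.append {u v w : G.Vertex} {p q : List D} (hp : G.IsPath u p v)
    (hq : G.IsPath v q w) : G.IsPath u (p ++ q) w := by
  induction p generalizing u with
  | nil => cases hp; exact hq
  | cons d p ih => exact ⟨hp.1, ih hp.2⟩

theorem IsPath.revPath {u v : G.Vertex} {p : List D} (hp : G.IsPath u p v) :
    G.IsPath v (G.revPath p) u := by
  induction p generalizing u with
  | nil => exact hp.symm
  | cons d p ih =>
    have h : G.revPath (d :: p) = G.revPath p ++ [G.rev d] := by simp [PlaneGraph.revPath]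
    rw [h]
    exact (ih hp.2).append ⟨rfl, by rw [head_rev]; exact hp.1⟩

theorem IsPath.tail_mem {u v : G.Vertex} {p : List D} (hp : G.IsPath u p v) {d : D} (hd : d ∈ p) :
    G.tail d ∈ u :: p.map G.head := by
  induction p generalizing u with
  | nil => simp at hd
  | cons e p ih =>
    rcases List.mem_cons.1 hd with rfl | hd
    · simp [hp.1]
    · exact List.mem_cons_of_mem _ (ih hp.2 hd)

theorem isPath_of_chain {g : ℕ → D} (hg : ∀ n, G.tail (g (n + 1)) = G.head (g n)) (n k : ℕ) :
    G.IsPath (G.tail (g n)) ((List.range' n k).map g) (G.tail (g (n + k))) := by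
  induction k generalizing n with
  | zero => rfl
  | succ k ih =>
    rw [List.range'_succ, List.map_cons]
    refine ⟨rfl, ?_⟩
    have := ih (n + 1)
    rwa [hg, show n + 1 + k = n + (k + 1) by omega] at this

theorem IsSimplePath.of_cons {u v : G.Vertex} {d : D} {p : List D}
    (h : G.IsSimplePath u (d :: p) v) : G.IsSimplePath (G.head d) p v :=
  ⟨h.1.2, (List.nodup_cons.1 h.2).2⟩

theorem IsSimplePath.nodup {u v : G.Vertex} {p : List D} (h : G.IsSimplePath u p v) : p.Nodup :=
  ((List.nodup_cons.1 h.2).2).of_map _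

theorem IsSimplePath.exists_suffix {u v w : G.Vertex} {p : List D} (h : G.IsSimplePath u p v)
    (hw : w ∈ u :: p.map G.head) : ∃ q, q ⊆ p ∧ G.IsSimplePath w q v := by
  induction p generalizing u with
  | nil =>
    obtain rfl : w = u := by simpa using hw
    exact ⟨[], fun _ h => h, h⟩
  | cons d p ih =>
    rcases List.mem_cons.1 hw with rfl | hw
    · exact ⟨_, fun _ h => h, h⟩
    · obtain ⟨q, hq, hq'⟩ := ih h.of_cons hw
      exact ⟨q, fun e he => List.mem_cons_of_mem _ (hq he), hq'⟩

theorem IsPath.exists_simple {u v : G.Vertex} {p : List D} (h : G.IsPath u p v) :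
    ∃ q, q ⊆ p ∧ G.IsSimplePath u q v := by
  induction p generalizing u with
  | nil => exact ⟨[], fun _ h => h, h, by simp⟩
  | cons d p ih =>
    obtain ⟨q, hq, hq'⟩ := ih h.2
    by_cases hu : u ∈ G.head d :: q.map G.head
    · obtain ⟨r, hr, hr'⟩ := hq'.exists_suffix hu
      exact ⟨r, fun e he => List.mem_cons_of_mem _ (hq (hr he)), hr'⟩
    · exact ⟨d :: q, List.cons_subset_cons _ hq, ⟨h.1, hq'.1⟩,
        List.nodup_cons.2 ⟨hu, hq'.2⟩⟩

/-- The vertices of a simple path can be numbered increasingly. -/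
theorem IsSimplePath.exists_height {u v : G.Vertex} {p : List D} (h : G.IsSimplePath u p v) :
    ∃ ht : G.Vertex → ℝ, ∀ d ∈ p, ht (G.tail d) < ht (G.head d) := by
  classical
  induction p generalizing u with
  | nil => exact ⟨0, by simp⟩
  | cons d p ih =>
    obtain ⟨ht, hht⟩ := ih h.of_cons
    have hu : u ∉ G.head d :: p.map G.head := (List.nodup_cons.1 h.2).1
    have hne : ∀ x ∈ G.head d :: p.map G.head, x ≠ u := fun x hx hxu => hu (hxu ▸ hx)
    refine ⟨Function.update ht u (ht (G.head d) - 1), fun e he => ?_⟩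
    rcases List.mem_cons.1 he with rfl | he
    · rw [h.1.1, Function.update_self, Function.update_of_ne (hne _ (by simp))]
      linarith
    · rw [Function.update_of_ne (hne _ (h.of_cons.1.tail_mem he)),
        Function.update_of_ne (hne _ (List.mem_cons_of_mem _ (List.mem_map_of_mem he)))]
      exact hht e he

theorem IsSimplePath.rev_notMem {u v : G.Vertex} {p : List D} (h : G.IsSimplePath u p v) {d : D}
    (hd : d ∈ p) : G.rev d ∉ p := by
  intro hr
  obtain ⟨ht, hht⟩ := h.exists_height
  have h1 := hht _ hd
  have h2 := hht _ hr
  rw [head_rev, tail_rev] at h2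
  linarith

/-- Following successors inside `B`, the walk closes a simple cycle at the first repetition of a
head. -/
theorem exists_simpleCycle {B : Set D} (hB : B.Nonempty)
    (hs : ∀ d ∈ B, ∃ e ∈ B, G.tail e = G.head d) :
    ∃ C, G.IsSimpleCycle C ∧ ∀ d ∈ C, d ∈ B := by
  classical
  obtain ⟨d₀, hd₀⟩ := hB
  choose! σ hσB hσ using hs
  let g : ℕ → D := fun n => σ^[n] d₀
  have hgB : ∀ n, g n ∈ B := by
    intro n
    induction n with
    | zero => exact hd₀
    | succ n ih =>
      change σ^[n + 1] d₀ ∈ B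
      rw [Function.iterate_succ_apply']
      exact hσB _ ih
  have hg : ∀ n, G.tail (g (n + 1)) = G.head (g n) := by
    intro n
    change G.tail (σ^[n + 1] d₀) = _
    rw [Function.iterate_succ_apply']
    exact hσ _ (hgB n)
  have hex : ∃ b, ∃ a, a < b ∧ G.head (g a) = G.head (g b) := by
    obtain ⟨x, y, hxy, h⟩ := Finite.exists_ne_map_eq_of_infinite fun n => G.head (g n)
    rcases lt_or_gt_of_ne hxy with h' | h'
    · exact ⟨y, x, h', h⟩
    · exact ⟨x, y, h', h.symm⟩
  obtain ⟨a, hab, hhead⟩ := Nat.find_spec hex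
  have hmin : ∀ y < Nat.find hex, ∀ x < y, G.head (g x) ≠ G.head (g y) :=
    fun y hy x hx h => Nat.find_min hex hy ⟨x, hx, h⟩
  set b := Nat.find hex
  -- Heads strictly before `b` are distinct by minimality; a head equal to that of `g b` would also
  -- equal that of `g a`, an earlier repetition.
  have hinj : ∀ x y, a < x → x < y → y ≤ b → G.head (g x) ≠ G.head (g y) := by
    intro x y hax hxy hyb h
    rcases hyb.lt_or_eq with hyb | rfl
    · exact hmin y hyb x hxy h
    · exact hmin x hxy a hax (hhead.trans h.symm)
  refine ⟨(List.range' (a + 1) (b - a)).map g, ⟨?_, ⟨G.head (g a), ?_⟩, ?_⟩, ?_⟩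
  · simp; omega
  · have h := isPath_of_chain hg (a + 1) (b - a)
    rwa [show a + 1 + (b - a) = b + 1 by omega, hg, hg, ← hhead] at h
  · rw [List.map_map]
    refine List.Nodup.map_on ?_ List.nodup_range'
    intro x hx y hy h
    rw [List.mem_range'_1] at hx hy
    by_contra hne
    rcases lt_or_gt_of_ne hne with h' | h'
    · exact hinj x y (by omega) h' (by omega) h
    · exact hinj y x (by omega) h' (by omega) h.symm
  · intro d hd
    obtain ⟨n, _, rfl⟩ := List.mem_map.1 hd
    exact hgB n

/-! ### Boundaries of sets of faces -/

theorem exists_boundary_dart {M : Set G.Face} {x y : G.Face} (hx : x ∉ M) (hy : y ∈ M) :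
    ∃ d, G.left d ∉ M ∧ G.right d ∈ M := by
  by_contra! h
  exact G.face_induction (S := fun z => z ∉ M) h hx y hy

theorem faceDiff_indicator_pos {M : Set G.Face} [DecidablePred (· ∈ M)] {d : D} :
    0 < G.faceDiff (fun x => if x ∈ M then 1 else 0) d ↔ G.left d ∉ M ∧ G.right d ∈ M := by
  rw [faceDiff_apply]
  by_cases h1 : G.left d ∈ M <;> by_cases h2 : G.right d ∈ M <;> simp [h1, h2]

/-- The boundary of a set of faces contains directed cycles, so no height function increases
along it. -/
theorem not_increasing_boundary {M : Set G.Face} {x y : G.Face} (hx : x ∉ M) (hy : y ∈ M)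
    (ht : G.Vertex → ℝ) (h : ∀ d, G.left d ∉ M → G.right d ∈ M → ht (G.tail d) < ht (G.head d)) :
    False := by
  classical
  set f := G.faceDiff fun x => if x ∈ M then 1 else 0 with hf
  -- A circulation pairs to zero with vertex functions, at tails and at heads alike; heights
  -- increasing along its positive darts would make the difference of the two sums positive.
  have h1 : ∑ d, f d * ht (G.tail d) = 0 :=
    G.sum_mul_tail_eq_zero fun v => Or.inr (G.outflow_faceDiff _ _)
  have h2 : ∑ d, f d * ht (G.head d) = 0 := by
    rw [← Equiv.sum_comp G.rev]
    simp only [hf, faceDiff_rev, head_rev, neg_mul, Finset.sum_neg_distrib, neg_eq_zero]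
    exact h1
  obtain ⟨d₀, hd₀⟩ := exists_boundary_dart hx hy
  have hpos : ∀ d, 0 < f d → 0 < f d * (ht (G.head d) - ht (G.tail d)) := fun d hd =>
    mul_pos hd (sub_pos.2 (h d (faceDiff_indicator_pos.1 hd).1 (faceDiff_indicator_pos.1 hd).2))
  have h3 : 0 < ∑ d, f d * (ht (G.head d) - ht (G.tail d)) := by
    refine Finset.sum_pos' (fun d _ => ?_) ⟨d₀, Finset.mem_univ _, hpos _
      (faceDiff_indicator_pos.2 hd₀)⟩
    rcases lt_trichotomy 0 (f d) with hd | hd | hd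
    · exact (hpos d hd).le
    · simp [← hd]
    · have hd' : 0 < f (G.rev d) := by rw [hf, faceDiff_rev, ← hf]; linarith
      have := hpos _ hd'
      rw [hf, faceDiff_rev, ← hf, head_rev, tail_rev] at this
      linarith
  simp only [mul_sub, Finset.sum_sub_distrib] at h3
  linarith

/-! ### Winding numbers -/

variable [DecidableEq D]

theorem count_revPath (p : List D) (d : D) : (G.revPath p).count d = p.count (G.rev d) := by
  rw [revPath, List.count_reverse]
  conv_lhs => rw [← G.rev_rev_apply d]
  exact List.count_map_of_injective _ _ G.rev.injective _

/-- The net number of traversals of a dart by a sequence of darts. -/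
def netCount (G : PlaneGraph D) (p : List D) (d : D) : ℝ := (p.count d : ℝ) - p.count (G.rev d)

theorem netCount_rev (p : List D) (d : D) : G.netCount p (G.rev d) = - G.netCount p d := by
  simp [netCount]

open Classical in
theorem outflow_netCount {u w : G.Vertex} {p : List D} (hp : G.IsPath u p w) (A : Set G.Vertex) :
    G.outflow A (G.netCount p) = (if u ∈ A then 1 else 0) - (if w ∈ A then 1 else 0) := by
  induction p generalizing u with
  | nil =>
    cases hp
    simp [outflow_apply, netCount]
  | cons d p ih =>
    have h : G.netCount (d :: p) =
        G.netCount p + (Pi.single d 1 - Pi.single (G.rev d) 1 : D → ℝ) := by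
      ext e
      have h1 : d = G.rev e ↔ e = G.rev d := by rw [← rev_eq_iff, eq_comm]
      simp only [netCount, List.count_cons, Pi.add_apply, Pi.sub_apply, Pi.single_apply,
        beq_iff_eq, h1, eq_comm (a := d)]
      push_cast
      ring
    have hs : ∀ e : D, G.outflow A (Pi.single e 1) = if G.tail e ∈ A then 1 else 0 := by
      intro e
      rw [outflow_apply, Finset.sum_eq_single e] <;> simp +contextual
    rw [h, map_add, map_sub, ih hp.2, hs, hs, tail_rev, hp.1]
    ring

/-- A closed walk is a circulation, hence has a potential; its differences across darts are
integers, so after normalization at `inf` it is integer valued. -/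
theorem exists_winding (inf : G.Face) {u : G.Vertex} {C : List D} (hC : G.IsPath u C u) :
    ∃ w, G.IsWinding inf C w := by
  obtain ⟨φ, hφ⟩ := G.exists_potential (netCount_rev C) fun v => by
    rw [outflow_netCount hC, sub_self]
  have hint : ∀ x, ∃ n : ℤ, φ x - φ inf = n := by
    refine G.face_induction (x := inf) ?_ ⟨0, by simp⟩
    rintro d ⟨n, hn⟩
    refine ⟨n + (C.count d - C.count (G.rev d)), ?_⟩
    have := hφ d
    simp only [netCount] at this
    push_cast
    linarith
  choose w hw using hint
  refine ⟨w, ?_, fun d => ?_⟩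
  · have := hw inf
    rw [sub_self] at this
    exact_mod_cast this.symm
  · have h1 := hφ d
    simp only [netCount] at h1
    have : ((w (G.right d) - w (G.left d) : ℤ) : ℝ) = ((C.count d - C.count (G.rev d) : ℤ) : ℝ) := by
      push_cast
      rw [← hw, ← hw]
      linarith
    exact_mod_cast this

theorem IsWinding.unique {inf : G.Face} {C : List D} {w w' : G.Face → ℤ}
    (h : G.IsWinding inf C w) (h' : G.IsWinding inf C w') : w = w' := by
  ext x
  refine G.face_induction (S := fun x => w x = w' x) (fun d hd => ?_) (h.1.trans h'.1.symm) x
  have h1 := h.2 d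
  have h2 := h'.2 d
  linarith

/-- A set of faces without the infinite face has a clockwise boundary cycle. -/
theorem exists_clockwise_boundary_cycle {inf : G.Face} {M : Set G.Face} (hinf : inf ∉ M)
    (hM : M.Nonempty) : ∃ C, G.IsSimpleCycle C ∧ G.IsClockwise inf C ∧
      ∀ d ∈ C, G.left d ∉ M ∧ G.right d ∈ M := by
  classical
  -- the component of the infinite face in the complement of `M`
  let N : Set G.Face := {x | Relation.ReflTransGen
    (fun x y => y ∉ M ∧ ∃ d, G.left d = x ∧ G.right d = y) inf x}
  have hNinf : inf ∈ N := Relation.ReflTransGen.refl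
  have hNM : ∀ x ∈ N, x ∉ M := by
    intro x hx
    rcases Relation.ReflTransGen.cases_tail hx with rfl | ⟨y, _, h, _⟩
    · exact hinf
    · exact h
  have hbd : ∀ d, G.left d ∈ N → G.right d ∉ N → G.right d ∈ M := fun d h1 h2 => by
    by_contra h
    exact h2 (Relation.ReflTransGen.tail h1 ⟨h, d, rfl, rfl⟩)
  obtain ⟨x, hx⟩ := hM
  have hB : {d | G.left d ∈ N ∧ G.right d ∉ N}.Nonempty := by
    obtain ⟨d, h1, h2⟩ := exists_boundary_dart (M := Nᶜ) (not_not.2 hNinf) fun h => hNM x h hx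
    exact ⟨d, not_not.1 h1, h2⟩
  -- The boundary of `N` is a circulation: since `d` enters its head, balance forces some boundary
  -- dart to leave it.
  obtain ⟨C, hC, hCB⟩ := exists_simpleCycle hB fun d hd => by
    have hsum := G.outflow_faceDiff (fun x => if x ∈ Nᶜ then 1 else 0) {G.head d}
    rw [outflow_apply] at hsum
    obtain ⟨e, -, he⟩ := Finset.exists_pos_of_sum_zero_of_exists_nonzero _ hsum
      ⟨G.rev d, Finset.mem_univ _, by simp [faceDiff_apply, hd.1, hd.2]⟩
    by_cases h : G.tail e = G.head d
    · simp only [Set.mem_singleton_iff, h, if_true] at he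
      have := faceDiff_indicator_pos.1 he
      exact ⟨e, ⟨not_not.1 this.1, this.2⟩, h⟩
    · simp [h] at he
  have hCrev : ∀ d ∈ C, G.rev d ∉ C := fun d hd hr => (hCB _ hr).2 (by
    rw [right_rev]; exact (hCB d hd).1)
  obtain ⟨u, hu⟩ := hC.2.1
  obtain ⟨w, hw⟩ := exists_winding inf hu
  -- Darts of `C` have left face in `N` and right face outside, so moving inside `N` never crosses
  -- `C`.
  have hw0 : ∀ x ∈ N, w x = 0 := by
    intro x hx
    change Relation.ReflTransGen _ _ _ at hx
    induction hx with
    | refl => exact hw.1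
    | @tail y z hy hyz ih =>
      obtain ⟨h, d, rfl, rfl⟩ := id hyz
      have h1 : d ∉ C := fun hd => (hCB d hd).2 (Relation.ReflTransGen.tail hy hyz)
      have h2 : G.rev d ∉ C := fun hd => (hCB _ hd).2 (by rw [right_rev]; exact hy)
      have h3 := hw.2 d
      rw [List.count_eq_zero_of_not_mem h1, List.count_eq_zero_of_not_mem h2] at h3
      simp only [ih] at h3
      linarith
  refine ⟨C, hC, ⟨w, hw, fun x => ?_, ?_⟩, fun d hd =>
    ⟨hNM _ (hCB d hd).1, hbd d (hCB d hd).1 (hCB d hd).2⟩⟩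
  -- Entering a region of negative winding crosses some dart of `C` from right to left, hence ends
  -- in `N`, where the winding is zero.
  · by_contra! hneg
    obtain ⟨d, h1, h2⟩ := exists_boundary_dart (M := {x | w x < 0}) (x := inf)
      (by simp [hw.1]) hneg
    simp only [Set.mem_ofPred_eq, not_lt] at h1 h2
    have h3 := hw.2 d
    have h4 : G.rev d ∈ C := List.count_pos_iff.1 (by omega)
    have h5 := hw0 _ (hCB _ h4).1
    rw [left_rev] at h5
    omega
  · obtain ⟨d, hd⟩ := List.exists_mem_of_ne_nil C hC.1
    have h3 := hw.2 d
    rw [hw0 _ (hCB d hd).1, List.count_eq_zero_of_not_mem (hCrev d hd)] at h3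
    have h4 := List.count_pos_iff.2 hd
    exact ⟨G.right d, by omega⟩

theorem IsWinding.diff_eq {inf : G.Face} {A P : List D} {w : G.Face → ℤ}
    (hw : G.IsWinding inf (A ++ G.revPath P) w) (d : D) : w (G.right d) - w (G.left d) =
      (A.count d + P.count (G.rev d) : ℤ) - (A.count (G.rev d) + P.count d) := by
  rw [hw.2 d, List.count_append, List.count_append, count_revPath, count_revPath, rev_rev_apply]
  push_cast
  ring

/-- A part of the boundary of the infinite face and the reverse of a simple path wind at most once
around each face, and clockwise. -/
theorem IsWinding.nonneg_and_le_one {inf : G.Face} {A P : List D} {w : G.Face → ℤ}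
    (hw : G.IsWinding inf (A ++ G.revPath P) w) (hA : ∀ d ∈ A, G.left d = inf) (hA' : A.Nodup)
    {u v : G.Vertex} (hP : G.IsSimplePath u P v) (x : G.Face) : 0 ≤ w x ∧ w x ≤ 1 := by
  obtain ⟨ht, hht⟩ := hP.exists_height
  constructor
  -- Darts of `A` have the infinite face on their left, so the boundary of the negative region
  -- consists of darts of `P`, along which `ht` increases.
  · by_contra! hneg
    refine not_increasing_boundary (M := {x | w x < 0}) (x := inf) (by simp [hw.1]) hneg ht
      fun d h1 h2 => hht d ?_
    simp only [Set.mem_ofPred_eq, not_lt] at h1 h2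
    by_contra hd
    have h3 := hw.diff_eq d
    rw [List.count_eq_zero_of_not_mem hd] at h3
    have h4 : G.rev d ∈ A := List.count_pos_iff.1 (by omega)
    have h5 := hA _ h4
    rw [left_rev] at h5
    rw [h5, hw.1] at h2
    exact lt_irrefl _ h2
  -- Crossing a dart of `A` reaches winding at most one, so the boundary of this region consists of
  -- reversed darts of `P`, along which `ht` decreases.
  · by_contra! hlt
    refine not_increasing_boundary (M := {x | 1 < w x}) (x := inf) (by simp [hw.1]) hlt
      (fun v => - ht v) fun d h1 h2 => neg_lt_neg ?_
    simp only [Set.mem_ofPred_eq, not_lt] at h1 h2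
    have h3 := hw.diff_eq d
    by_cases hd : G.rev d ∈ P
    · simpa using hht _ hd
    · exfalso
      rw [List.count_eq_zero_of_not_mem hd] at h3
      have h4 : d ∈ A := List.count_pos_iff.1 (by omega)
      have h5 := hA _ h4
      have h6 := List.nodup_iff_count_le_one.1 hA' d
      rw [h5, hw.1] at h3
      omega

end

end PlaneGraph

namespace PlaneGraph

section

variable {D : Type*} [Fintype D] {G : PlaneGraph D}

/-! ### Residually closed sets of vertices -/

/-- No dart of positive capacity leaves the set of vertices `A`. -/
def IsClosedUnder (G : PlaneGraph D) (c : D → ℝ) (A : Set G.Vertex) : Prop :=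
  ∀ d, G.tail d ∈ A → G.head d ∉ A → c d ≤ 0

/-- Some set closed under `c` contains `u` but not `v`, i.e. no path from `u` to `v` is residual. -/
def Blocked (G : PlaneGraph D) (c : D → ℝ) (u v : G.Vertex) : Prop :=
  ∃ A, G.IsClosedUnder c A ∧ u ∈ A ∧ v ∉ A

theorem IsClosedUnder.mem_of_path {c : D → ℝ} {A : Set G.Vertex} (hA : G.IsClosedUnder c A)
    {u v : G.Vertex} {p : List D} (hp : G.IsPath u p v) (hc : Residual c p) (hu : u ∈ A) :
    v ∈ A := by
  induction p generalizing u with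
  | nil => cases hp; exact hu
  | cons d p ih =>
    refine ih hp.2 (fun e he => hc e (List.mem_cons_of_mem _ he)) ?_
    by_contra h
    exact (hc d List.mem_cons_self).not_ge (hA d (hp.1 ▸ hu) h)

theorem IsClosedUnder.mem_of_onPath {c : D → ℝ} {A : Set G.Vertex} (hA : G.IsClosedUnder c A)
    {u v x : G.Vertex} {p : List D} (hp : G.IsPath u p v) (hc : Residual c p)
    (hx : G.OnPath p x) (hxA : x ∈ A) : v ∈ A := by
  induction p generalizing u with
  | nil => obtain ⟨d, hd, _⟩ := hx; simp at hd
  | cons d p ih =>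
    have hc' : Residual c p := fun e he => hc e (List.mem_cons_of_mem _ he)
    obtain ⟨e, he, hx⟩ := hx
    rcases List.mem_cons.1 he with rfl | he
    · rcases hx with rfl | rfl
      · exact hA.mem_of_path hp hc (hp.1 ▸ hxA)
      · exact hA.mem_of_path hp.2 hc' hxA
    · exact ih hp.2 hc' ⟨e, he, hx⟩

/-- The vertices that can be reached from `S` through darts of positive capacity. -/
def reach (G : PlaneGraph D) (c : D → ℝ) (S : Set G.Vertex) : Set G.Vertex :=
  {v | ∃ u ∈ S, ∃ p, G.IsPath u p v ∧ Residual c p}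

theorem isClosedUnder_reach (c : D → ℝ) (S : Set G.Vertex) :
    G.IsClosedUnder c (G.reach c S) := by
  rintro d ⟨u, hu, p, hp, hc⟩ hd
  by_contra! hpos
  refine hd ⟨u, hu, p ++ [d], hp.append ⟨rfl, rfl⟩, fun e he => ?_⟩
  rcases List.mem_append.1 he with he | he
  · exact hc e he
  · rwa [List.mem_singleton.1 he]

theorem subset_reach (c : D → ℝ) (S : Set G.Vertex) : S ⊆ G.reach c S :=
  fun u hu => ⟨u, hu, [], rfl, by simp [Residual]⟩

theorem blocked_of_forall_not_residual {c : D → ℝ} {u v : G.Vertex}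
    (h : ∀ p, G.IsPath u p v → ¬ Residual c p) : G.Blocked c u v := by
  refine ⟨G.reach c {u}, isClosedUnder_reach _ _, subset_reach _ _ rfl, ?_⟩
  rintro ⟨_, rfl, p, hp, hc⟩
  exact h p hp hc

theorem Blocked.not_residual {c : D → ℝ} {u v : G.Vertex} (h : G.Blocked c u v) {p : List D}
    (hp : G.IsPath u p v) : ¬ Residual c p := by
  obtain ⟨A, hA, hu, hv⟩ := h
  exact fun hc => hv (hA.mem_of_path hp hc hu)

theorem Blocked.mono {c c' : D → ℝ} {u v : G.Vertex} (h : G.Blocked c u v)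
    (hcc' : ∀ d, c d ≤ 0 → c' d ≤ 0) : G.Blocked c' u v := by
  obtain ⟨A, hA, hu, hv⟩ := h
  exact ⟨A, fun d h1 h2 => hcc' d (hA d h1 h2), hu, hv⟩

/-! ### Flows -/

theorem isFlow_zero {c : D → ℝ} (hc : ∀ d, 0 ≤ c d) (T : Set G.Vertex) : G.IsFlow c T 0 :=
  G.isFlow_iff.2 ⟨by simp, hc, by simp⟩

theorem IsFlow.residualCap_nonneg {c : D → ℝ} {T : Set G.Vertex} {f : D → ℝ}
    (hf : G.IsFlow c T f) (d : D) : 0 ≤ residualCap c f d :=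
  sub_nonneg.2 (hf.2.1 d)

theorem IsFlow.mono {c : D → ℝ} {T T' : Set G.Vertex} {f : D → ℝ} (hf : G.IsFlow c T f)
    (h : T ⊆ T') : G.IsFlow c T' f :=
  ⟨hf.1, hf.2.1, fun v hv => hf.2.2 v fun hv' => hv (h hv')⟩

theorem IsFlow.add {c : D → ℝ} {T : Set G.Vertex} {f g : D → ℝ} (hf : G.IsFlow c T f)
    (hg : G.IsFlow (residualCap c f) T g) : G.IsFlow c T (f + g) := by
  rw [isFlow_iff] at *
  refine ⟨fun d => ?_, fun d => ?_, fun v hv => ?_⟩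
  · rw [Pi.add_apply, Pi.add_apply, hf.1, hg.1]; ring
  · have := hg.2.1 d
    simp only [residualCap] at this
    rw [Pi.add_apply]
    linarith
  · rw [map_add, hf.2.2 v hv, hg.2.2 v hv, add_zero]

theorem residualCap_sub_self {D : Type*} (c c' : D → ℝ) : residualCap c (c - c') = c' := by
  ext d
  simp [residualCap]

theorem IsFlow.sub {c c' : D → ℝ} {T : Set G.Vertex} {f : D → ℝ} (hf : G.IsFlow c T f)
    (hg : G.IsFlow c T (c - c')) : G.IsFlow c' T (f - (c - c')) := by
  rw [isFlow_iff] at *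
  refine ⟨fun d => ?_, fun d => ?_, fun v hv => ?_⟩
  · rw [Pi.sub_apply, hf.1, hg.1, Pi.sub_apply f]; ring
  · have := hf.2.1 d
    simp only [Pi.sub_apply]
    linarith
  · rw [map_sub, hf.2.2 v hv, hg.2.2 v hv, sub_zero]

theorem flowValue_add (T : Set G.Vertex) (f g : D → ℝ) :
    G.flowValue T (f + g) = G.flowValue T f + G.flowValue T g := by
  classical
  simp only [flowValue, ← Finset.sum_add_distrib]
  exact Finset.sum_congr rfl fun d _ => by split_ifs <;> simp

/-- The value of a flow is its net outflow at the sources. -/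
theorem flowValue_eq_outflow {S T : Set G.Vertex} (hST : Disjoint S T) {f : D → ℝ}
    (hf : ∀ d, f (G.rev d) = - f d) (hbal : ∀ v, v ∉ S ∪ T → G.outflow {v} f = 0) :
    G.flowValue T f = G.outflow S f := by
  have h1 := G.outflow_union hST f
  have h2 : G.outflow (S ∪ T) f = G.outflow Set.univ f :=
    G.outflow_congr hbal fun v hv => by simp only [hv, Set.mem_univ]
  rw [G.outflow_univ hf] at h2
  rw [G.flowValue_eq hf]
  linarith

theorem flowValue_eq_outflow_of_separating {S T A : Set G.Vertex} (hSA : S ⊆ A)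
    (hTA : Disjoint T A) {f : D → ℝ} (hf : ∀ d, f (G.rev d) = - f d)
    (hbal : ∀ v, v ∉ S ∪ T → G.outflow {v} f = 0) : G.flowValue T f = G.outflow A f := by
  rw [flowValue_eq_outflow (hTA.symm.mono_left hSA) hf hbal]
  refine G.outflow_congr hbal fun v hv => ⟨fun h => hSA h, fun h => ?_⟩
  exact hv.resolve_right fun h' => Set.disjoint_left.1 hTA h' h

/-- The vertices residually reachable from `S` form a cut saturated by `f`. -/
theorem isMaxFlow_of_blocked {c : D → ℝ} {S T : Set G.Vertex} {f : D → ℝ}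
    (hf : G.IsFlow c (S ∪ T) f)
    (h : ∀ u ∈ S, ∀ v ∈ T, G.Blocked (residualCap c f) u v) : G.IsMaxFlow c S T f := by
  classical
  refine ⟨hf, fun g hg => ?_⟩
  have hSA := subset_reach (residualCap c f) S
  have hTA : Disjoint T (G.reach (residualCap c f) S) := by
    rw [Set.disjoint_left]
    rintro v hv ⟨u, hu, p, hp, hc⟩
    exact (h u hu v hv).not_residual hp hc
  rw [isFlow_iff] at hf hg
  rw [flowValue_eq_outflow_of_separating hSA hTA hg.1 hg.2.2,
    flowValue_eq_outflow_of_separating hSA hTA hf.1 hf.2.2,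
    G.outflow_eq_sum_leaving hg.1, G.outflow_eq_sum_leaving hf.1]
  refine Finset.sum_le_sum fun d _ => ?_
  split_ifs with hd
  · have h1 := isClosedUnder_reach (residualCap c f) S d hd.1 hd.2
    have h2 := hg.2.1 d
    simp only [residualCap] at h1
    linarith
  · exact le_rfl

theorem IsMaxFlow.flowValue_nonneg {c : D → ℝ} (hc : ∀ d, 0 ≤ c d) {S T : Set G.Vertex}
    {f : D → ℝ} (hf : G.IsMaxFlow c S T f) : 0 ≤ G.flowValue T f := by
  have := hf.2 0 (isFlow_zero hc _)
  simpa [flowValue] using this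

/-- A maximum `st`-flow preserves closed sets that contain `s` if they contain `t`. -/
theorem IsMaxFlow.isClosedUnder_residualCap {c : D → ℝ} (hc : ∀ d, 0 ≤ c d) {s t : G.Vertex}
    {f : D → ℝ} (hf : G.IsMaxFlow c {s} {t} f) {A : Set G.Vertex}
    (hA : G.IsClosedUnder c A) (h : t ∈ A → s ∈ A) :
    G.IsClosedUnder (residualCap c f) A := by
  classical
  have hflow := G.isFlow_iff.1 hf.1
  have hval := hf.flowValue_nonneg hc
  have hle : ∀ d, (if G.tail d ∈ A ∧ G.head d ∉ A then f d else 0) ≤ 0 := by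
    intro d
    split_ifs with hd
    · exact (hflow.2.1 d).trans (hA d hd.1 hd.2)
    · exact le_rfl
  -- The outflow of `A` is the flow value if `A` separates $s$ from $t$, and zero otherwise. No
  -- leaving dart carries positive flow, so all of them carry zero.
  have hout : 0 ≤ G.outflow A f := by
    by_cases hs : s ∈ A
    · by_cases ht : t ∈ A
      · have : G.outflow A f = G.outflow Set.univ f := by
          refine G.outflow_congr hflow.2.2 ?_
          rintro v (hv | hv) <;> rw [Set.mem_singleton_iff.1 hv] <;> simp [hs, ht]
        rw [this, G.outflow_univ hflow.1]
      · rwa [← flowValue_eq_outflow_of_separating (T := {t}) (by simpa using hs)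
          (by simpa using ht) hflow.1 hflow.2.2]
    · have ht : t ∉ A := fun ht => hs (h ht)
      have : G.outflow A f = G.outflow ∅ f := by
        refine G.outflow_congr hflow.2.2 ?_
        rintro v (hv | hv) <;> rw [Set.mem_singleton_iff.1 hv] <;> simp [hs, ht]
      rw [this, G.outflow_empty]
  rw [G.outflow_eq_sum_leaving hflow.1] at hout
  have h0 := (Finset.sum_eq_zero_iff_of_nonpos fun d _ => hle d).1
    (le_antisymm (Finset.sum_nonpos fun d _ => hle d) hout)
  intro d h1 h2
  have h3 := h0 d (Finset.mem_univ d)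
  rw [if_pos ⟨h1, h2⟩] at h3
  simpa [residualCap, h3] using hA d h1 h2

variable [DecidableEq D]

theorem IsSimplePath.netCount_eq {u v : G.Vertex} {p : List D} (hp : G.IsSimplePath u p v)
    (d : D) : G.netCount p d = if d ∈ p then 1 else if G.rev d ∈ p then -1 else 0 := by
  rw [netCount, hp.nodup.count, hp.nodup.count]
  by_cases h : d ∈ p
  · simp [h, hp.rev_notMem h]
  · by_cases h' : G.rev d ∈ p <;> simp [h, h']

theorem flowValue_smul_netCount {u v : G.Vertex} {p : List D} (hp : G.IsPath u p v)
    {T : Set G.Vertex} (hu : u ∉ T) (hv : v ∈ T) (δ : ℝ) :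
    G.flowValue T (δ • G.netCount p) = δ := by
  rw [G.flowValue_eq fun d => by simp [netCount_rev], map_smul, outflow_netCount hp]
  simp [hu, hv]

theorem outflow_netCount_eq_zero {u v x : G.Vertex} {p : List D} (hp : G.IsPath u p v)
    (hu : x ≠ u) (hv : x ≠ v) : G.outflow {x} (G.netCount p) = 0 := by
  rw [outflow_netCount hp]
  simp [hu.symm, hv.symm]

theorem IsMaxFlow.blocked {c : D → ℝ} {s t : G.Vertex} {f : D → ℝ}
    (hf : G.IsMaxFlow c {s} {t} f) (hst : s ≠ t) : G.Blocked (residualCap c f) s t := by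
  refine blocked_of_forall_not_residual fun p hp hres => ?_
  obtain ⟨q, hqp, hq⟩ := hp.exists_simple
  have hne : q.toFinset.Nonempty := by
    rw [List.toFinset_nonempty_iff]
    rintro rfl
    exact hst hq.1
  -- The bottleneck of a residual simple path could be pushed along it, increasing the value.
  obtain ⟨z, hz, hmin⟩ := q.toFinset.exists_min_image (residualCap c f) hne
  have hδ : 0 < residualCap c f z := hres z (hqp (List.mem_toFinset.1 hz))
  have hflow : G.IsFlow (residualCap c f) ({s} ∪ {t}) (residualCap c f z • G.netCount q) := by
    refine G.isFlow_iff.2 ⟨fun d => by simp [netCount_rev], fun d => ?_, fun v hv => ?_⟩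
    · have h0 := hf.1.residualCap_nonneg d
      rw [Pi.smul_apply, hq.netCount_eq, smul_eq_mul]
      split_ifs with h1 h2
      · simpa using hmin d (List.mem_toFinset.2 h1)
      · linarith
      · linarith
    · rw [Set.mem_union, not_or] at hv
      rw [map_smul, outflow_netCount_eq_zero hq.1 hv.1 hv.2, smul_zero]
  have h1 := hf.2 _ (hf.1.add hflow)
  rw [flowValue_add, flowValue_smul_netCount hq.1 (by simpa using hst) (by simp)] at h1
  linarith

/-- Flow decomposition: a flow can be replaced by one that is at least as large and uses only
simple paths from sources to sinks. -/
theorem exists_path_flow {S T : Set G.Vertex} (hST : Disjoint S T) {f : D → ℝ}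
    (hf : ∀ d, f (G.rev d) = - f d) (hbal : ∀ v, v ∉ S ∪ T → G.outflow {v} f = 0) :
    ∃ g : D → ℝ, (∀ d, g (G.rev d) = - g d) ∧ (∀ v, v ∉ S ∪ T → G.outflow {v} g = 0) ∧
      (∀ d, g d ≤ max (f d) 0) ∧ G.flowValue T f ≤ G.flowValue T g ∧
      ∀ d, 0 < g d → ∃ u ∈ S, ∃ v ∈ T, ∃ Z, G.IsSimplePath u Z v ∧ d ∈ Z ∧ Residual f Z := by
  classical
  -- Subtracting a source-to-sink path with its bottleneck amount makes no new dart positive and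
  -- empties the bottleneck dart `z`.
  induction hn : (Finset.univ.filter fun d => 0 < f d).card using Nat.strong_induction_on
    generalizing f with
  | _ n ih =>
  by_cases hval : G.flowValue T f ≤ 0
  · exact ⟨0, by simp, by simp, by simp, by simpa [flowValue] using hval, by simp⟩
  push Not at hval
  obtain ⟨u, hu, v, hv, Z, hZ, hres⟩ : ∃ u ∈ S, ∃ v ∈ T, ∃ Z, G.IsSimplePath u Z v ∧
      Residual f Z := by
    -- Otherwise the set reachable from `S` along positive flow misses `T`, and no flow leaves it,
    -- against the positive value.
    by_contra! hno
    have hTA : Disjoint T (G.reach f S) := by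
      rw [Set.disjoint_left]
      rintro v hv ⟨u, hu, p, hp, hc⟩
      obtain ⟨q, hqp, hq⟩ := hp.exists_simple
      exact hno u hu v hv q hq fun d hd => hc d (hqp hd)
    rw [flowValue_eq_outflow_of_separating (subset_reach f S) hTA hf hbal,
      G.outflow_eq_sum_leaving hf] at hval
    refine hval.not_ge (Finset.sum_nonpos fun d _ => ?_)
    split_ifs with hd
    · exact isClosedUnder_reach f S d hd.1 hd.2
    · exact le_rfl
  have huT : u ∉ T := Set.disjoint_left.1 hST hu
  have hne : Z.toFinset.Nonempty := by
    rw [List.toFinset_nonempty_iff]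
    rintro rfl
    exact huT (hZ.1 ▸ hv)
  obtain ⟨z, hz, hmin⟩ := Z.toFinset.exists_min_image f hne
  rw [List.mem_toFinset] at hz
  replace hmin : ∀ d ∈ Z, f z ≤ f d := fun d hd => hmin d (List.mem_toFinset.2 hd)
  have hδ := hres z hz
  have hZbal : ∀ x, x ∉ S ∪ T → G.outflow {x} (G.netCount Z) = 0 := fun x hx =>
    outflow_netCount_eq_zero hZ.1 (fun h => hx (Or.inl (h ▸ hu))) fun h => hx (Or.inr (h ▸ hv))
  have hf' : ∀ d, (f - f z • G.netCount Z) d =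
      f d - f z * (if d ∈ Z then 1 else if G.rev d ∈ Z then -1 else 0) := fun d => by
    rw [← hZ.netCount_eq]; simp
  have hpos : ∀ d, 0 < (f - f z • G.netCount Z) d → 0 < f d := by
    intro d hd
    rw [hf'] at hd
    split_ifs at hd with h1 h2
    · exact hres d h1
    · have := hmin _ h2
      rw [hf] at this
      linarith
    · linarith
  obtain ⟨g, hg1, hg2, hg3, hg4, hg5⟩ := ih _ (by
    rw [← hn]
    refine Finset.card_lt_card ⟨fun d hd => ?_, fun hsub => ?_⟩
    · simp only [Finset.mem_filter, Finset.mem_univ, true_and] at hd ⊢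
      exact hpos d hd
    · have := hsub (Finset.mem_filter.2 ⟨Finset.mem_univ z, hδ⟩)
      rw [Finset.mem_filter, hf' z, if_pos hz] at this
      linarith [this.2]) (f := f - f z • G.netCount Z)
    (fun d => by simp [hf, netCount_rev]; ring)
    (fun x hx => by rw [map_sub, map_smul, hbal x hx, hZbal x hx]; simp) rfl
  refine ⟨g + f z • G.netCount Z, fun d => by simp [hg1, netCount_rev]; ring,
    fun x hx => by rw [map_add, map_smul, hg2 x hx, hZbal x hx]; simp, fun d => ?_, ?_,
    fun d hd => ?_⟩
  · have h := hg3 d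
    rw [hf'] at h
    rw [Pi.add_apply, Pi.smul_apply, hZ.netCount_eq, smul_eq_mul]
    split_ifs at h ⊢ with h1 h2
    · have := hmin d h1
      rw [max_eq_left (by linarith)] at h
      exact le_max_of_le_left (by linarith)
    · have := hmin _ h2
      rw [hf] at this
      rw [max_eq_right (by linarith)] at h
      exact le_max_of_le_right (by linarith)
    · simpa using h
  · rw [← sub_add_cancel f (f z • G.netCount Z), flowValue_add, flowValue_add]
    simpa using hg4
  · by_cases hdZ : d ∈ Z
    · exact ⟨u, hu, v, hv, Z, hZ, hdZ, hres⟩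
    · have hgd : 0 < g d := by
        rw [Pi.add_apply, Pi.smul_apply, hZ.netCount_eq, if_neg hdZ, smul_eq_mul] at hd
        split_ifs at hd <;> linarith
      obtain ⟨u', hu', v', hv', Z', hZ', hdZ', hres'⟩ := hg5 d hgd
      exact ⟨u', hu', v', hv', Z', hZ', hdZ', fun e he => hpos e (hres' e he)⟩

end

end PlaneGraph

/-! ### The order of the iterations -/

theorem mem_iterations {m : ℕ} {p : Fin m × Fin m} : p ∈ iterations m ↔ p.1 ≤ p.2 := by
  obtain ⟨k, l⟩ := p
  simp [iterations]

/-- The order in which the iterations are performed. -/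
def IterationBefore {m : ℕ} (p q : Fin m × Fin m) : Prop :=
  p.2 < q.2 ∨ p.2 = q.2 ∧ q.1 < p.1

theorem pairwise_iterations (m : ℕ) : (iterations m).Pairwise IterationBefore := by
  rw [iterations, List.pairwise_flatMap]
  refine ⟨fun j _ => ?_, ?_⟩
  · rw [List.pairwise_map, List.pairwise_reverse]
    exact ((List.pairwise_lt_finRange m).filter _).imp fun h => Or.inr ⟨rfl, h⟩
  · refine (List.pairwise_lt_finRange m).imp fun h x hx y hy => ?_
    obtain ⟨_, _, rfl⟩ := List.mem_map.1 hx
    obtain ⟨_, _, rfl⟩ := List.mem_map.1 hy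
    exact Or.inl h

theorem mem_before_iff {m : ℕ} {b a : List (Fin m × Fin m)} {i j : Fin m}
    (h : iterations m = b ++ (i, j) :: a) {k l : Fin m} :
    (k, l) ∈ b ↔ k ≤ l ∧ (l < j ∨ l = j ∧ i < k) := by
  have hp := pairwise_iterations m
  rw [h, List.pairwise_append, List.pairwise_cons] at hp
  have hmem : (k, l) ∈ b ++ (i, j) :: a ↔ k ≤ l := by rw [← h, mem_iterations]
  constructor
  · intro hb
    exact ⟨hmem.1 (List.mem_append_left _ hb), hp.2.2 _ hb _ List.mem_cons_self⟩
  · rintro ⟨hkl, hord⟩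
    rcases List.mem_append.1 (hmem.2 hkl) with hb | ha
    · exact hb
    · exfalso
      rcases List.mem_cons.1 ha with heq | ha
      · rw [Prod.mk.injEq] at heq
        omega
      · have := hp.2.1.1 _ ha
        simp only [IterationBefore] at this
        omega

/-! ### Source-sink pairs that remain blocked through the iterations -/

namespace PlaneGraph

namespace Terminals

section

variable {D : Type*} [Fintype D] {G : PlaneGraph D} {m : ℕ} (T : G.Terminals m)

theorem s_ne_t (i j : Fin m) : T.s i ≠ T.t j := fun h => by
  have := T.distinct (a₁ := (Sum.inl i)) (a₂ := (Sum.inr j)) h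
  simp at this

theorem disjoint_range : Disjoint (Set.range T.s) (Set.range T.t) := by
  rw [Set.disjoint_left]
  rintro _ ⟨i, rfl⟩ ⟨j, h⟩
  exact T.s_ne_t i j h.symm

/-- No path from `s_k` to `t_l` is residual if `l < k` or the pair `(k, l)` is in `L`. -/
def BlockedPairs (c : D → ℝ) (L : List (Fin m × Fin m)) : Prop :=
  ∀ k l, (l < k ∨ (k, l) ∈ L) → G.Blocked c (T.s k) (T.t l)

variable {T}

/-- The separating set of $(k,l)$ may contain $t_j$ and not $s_i$, and then the flow can destroy it.
It is therefore corrected first by the separating set of another blocked pair. -/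
theorem BlockedPairs.step {c f : D → ℝ} (hc : ∀ d, 0 ≤ c d) {b a : List (Fin m × Fin m)}
    {i j : Fin m} (hij : iterations m = b ++ (i, j) :: a) (h : T.BlockedPairs c b)
    [DecidableEq D] (hf : G.IsMaxFlow c {T.s i} {T.t j} f) :
    T.BlockedPairs (residualCap c f) (b ++ [(i, j)]) := by
  have hle : i ≤ j := mem_iterations.1 (show (i, j) ∈ iterations m by simp [hij])
  intro k l hkl
  by_cases heq : k = i ∧ l = j
  · rw [heq.1, heq.2]
    exact hf.blocked (T.s_ne_t i j)
  have hkl' : l < k ∨ l < j ∨ l = j ∧ i < k := by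
    rcases hkl with h | h
    · exact Or.inl h
    rcases List.mem_append.1 h with h | h
    · exact Or.inr ((mem_before_iff hij).1 h).2
    · rw [List.mem_singleton, Prod.mk.injEq] at h
      exact absurd h heq
  have hblock : ∀ k l, (l < k ∨ l < j ∨ l = j ∧ i < k) → G.Blocked c (T.s k) (T.t l) := by
    intro k l hkl
    refine h k l ?_
    rw [mem_before_iff hij]
    omega
  obtain ⟨A, hA, hk, hl⟩ := hblock k l hkl'
  -- For $k>i$ the pair $(k,j)$ is blocked, and the intersection omits $t_j$. For $k\le i$ one has
  -- $l<j$, so $(i,l)$ is blocked, and the union contains $s_i$.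
  by_cases hki : i < k
  · obtain ⟨A', hA', hk', hj'⟩ := hblock k j (by omega)
    have hA'' := hf.isClosedUnder_residualCap hc (A := A ∩ A') (fun d h1 h2 => by
      by_cases h3 : G.head d ∈ A
      · exact hA' d h1.2 fun h4 => h2 ⟨h3, h4⟩
      · exact hA d h1.1 h3) fun h => absurd h.2 hj'
    exact ⟨_, hA'', ⟨hk, hk'⟩, fun h => hl h.1⟩
  · obtain ⟨A', hA', hi', hl'⟩ := hblock i l (by omega)
    have hA'' := hf.isClosedUnder_residualCap hc (A := A ∪ A') (fun d h1 h2 => by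
      rcases h1 with h1 | h1
      · exact hA d h1 fun h3 => h2 (Or.inl h3)
      · exact hA' d h1 fun h3 => h2 (Or.inr h3)) fun _ => Or.inr hi'
    exact ⟨_, hA'', Or.inl hk, fun h => h.elim hl hl'⟩

variable [DecidableEq D]

theorem isFlow_of_isLeftmostMaxFlow {c f : D → ℝ} {i j : Fin m}
    (hf : G.IsLeftmostMaxFlow T.inf c (T.s i) (T.t j) f) :
    G.IsFlow c (Set.range T.s ∪ Set.range T.t) f :=
  hf.1.1.mono (Set.union_subset_union (by simp) (by simp))

theorem Run.isFlow {L : List (Fin m × Fin m)} {c c' : D → ℝ} (h : T.Run L c c')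
    (hc : ∀ d, 0 ≤ c d) : G.IsFlow c (Set.range T.s ∪ Set.range T.t) (c - c') := by
  induction h with
  | nil c => rw [sub_self]; exact isFlow_zero hc _
  | @cons i j L c f c' hf _ ih =>
    have hflow := isFlow_of_isLeftmostMaxFlow hf
    have h := hflow.add (ih hflow.residualCap_nonneg)
    have heq : f + (residualCap c f - c') = c - c' := by
      ext d
      simp only [residualCap, Pi.add_apply, Pi.sub_apply]
      ring
    rwa [heq] at h

theorem Run.nonneg {L : List (Fin m × Fin m)} {c c' : D → ℝ} (h : T.Run L c c')
    (hc : ∀ d, 0 ≤ c d) (d : D) : 0 ≤ c' d := by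
  have := (h.isFlow hc).2.1 d
  rw [Pi.sub_apply] at this
  linarith

theorem Run.blockedPairs {L b a : List (Fin m × Fin m)} {c c' : D → ℝ} (h : T.Run L c c')
    (hL : iterations m = b ++ (L ++ a)) (hc : ∀ d, 0 ≤ c d) (hb : T.BlockedPairs c b) :
    T.BlockedPairs c' (b ++ L) := by
  induction h generalizing b with
  | nil c => simpa using hb
  | @cons i j L c f c' hf _ ih =>
    rw [← List.singleton_append, ← List.append_assoc]
    exact ih (by simpa using hL) hf.1.1.residualCap_nonneg (hb.step hc (by simpa using hL) hf.1)

end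

end Terminals

end PlaneGraph

namespace PlaneGraph

theorem deleteCap_le {D : Type*} {c : D → ℝ} (hc : ∀ d, 0 ≤ c d) (X : Set D) (d : D) :
    deleteCap c X d ≤ c d := by
  rw [deleteCap]
  split_ifs
  · exact hc d
  · exact le_rfl

theorem deleteCap_nonneg {D : Type*} {c : D → ℝ} (hc : ∀ d, 0 ≤ c d) (X : Set D) (d : D) :
    0 ≤ deleteCap c X d := by
  rw [deleteCap]
  split_ifs
  · exact le_rfl
  · exact hc d

section

variable {D : Type*} [Fintype D] {G : PlaneGraph D}

theorem IsPath.onPath_end {u v : G.Vertex} {p : List D} (hp : G.IsPath u p v) (hne : p ≠ []) :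
    G.OnPath p v := by
  induction p generalizing u with
  | nil => exact absurd rfl hne
  | cons d p ih =>
    by_cases h : p = []
    · subst h
      exact ⟨d, List.mem_cons_self, Or.inr hp.2.symm⟩
    · obtain ⟨e, he, hv⟩ := ih hp.2 h
      exact ⟨e, List.mem_cons_of_mem _ he, hv⟩

theorem IsClosedUnder.forall_mem {c : D → ℝ} {A : Set G.Vertex} (hA : G.IsClosedUnder c A)
    {u v : G.Vertex} {p : List D} (hp : G.IsPath u p v) (hc : Residual c p) (hu : u ∈ A) :
    ∀ x ∈ u :: p.map G.head, x ∈ A := by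
  induction p generalizing u with
  | nil => simpa using hu
  | cons d p ih =>
    intro x hx
    rcases List.mem_cons.1 hx with rfl | hx
    · exact hu
    · refine ih hp.2 (fun e he => hc e (List.mem_cons_of_mem _ he)) ?_ x hx
      by_contra h
      exact (hc d List.mem_cons_self).not_ge (hA d (hp.1 ▸ hu) h)

namespace Terminals

variable {m : ℕ} (T : G.Terminals m)

/-! ### The boundary arcs between terminals -/

theorem posS_mono {k i : Fin m} (h : k ≤ i) : T.posS k ≤ T.posS i := by
  rcases h.lt_or_eq with h | rfl
  · exact ((T.posS_lt_posT k).trans (T.posT_lt_posS k i h)).le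
  · exact le_rfl

theorem posT_strictMono {j l : Fin m} (h : j < l) : T.posT j < T.posT l :=
  (T.posT_lt_posS j l h).trans (T.posS_lt_posT l)

theorem posT_mono {j l : Fin m} (h : j ≤ l) : T.posT j ≤ T.posT l := by
  rcases h.lt_or_eq with h | rfl
  · exact (T.posT_strictMono h).le
  · exact le_rfl

theorem posS_lt_posT_of_le {i j : Fin m} (h : i ≤ j) : T.posS i < T.posT j :=
  (T.posS_lt_posT i).trans_le (T.posT_mono h)

theorem left_iterate (n : ℕ) : G.left (G.facePerm^[n] T.base) = T.inf := by
  induction n with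
  | zero => rfl
  | succ n ih => rw [Function.iterate_succ_apply', left_facePerm, ih]

theorem iterate_inj {a b : ℕ} {i j : Fin m} (ha : a ≤ T.posT i) (hb : b ≤ T.posT j)
    (h : G.facePerm^[a] T.base = G.facePerm^[b] T.base) : a = b :=
  Function.iterate_injOn_Iio_minimalPeriod (ha.trans_lt (T.posT_lt i)) (hb.trans_lt (T.posT_lt j)) h

theorem mem_arc {i j : Fin m} (hij : i ≤ j) {d : D} :
    d ∈ T.arc i j ↔ ∃ n, T.posS i ≤ n ∧ n < T.posT j ∧ G.facePerm^[n] T.base = d := by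
  have := T.posS_lt_posT_of_le hij
  simp only [arc, List.mem_map, List.mem_range'_1, and_assoc]
  exact exists_congr fun n => and_congr_right fun _ => by
    rw [show T.posS i + (T.posT j - T.posS i) = T.posT j by omega]

theorem arc_nodup {i j : Fin m} (hij : i ≤ j) : (T.arc i j).Nodup := by
  have := T.posS_lt_posT_of_le hij
  refine List.Nodup.map_on (fun a ha b hb h => ?_) List.nodup_range'
  rw [List.mem_range'_1] at ha hb
  exact T.iterate_inj (i := j) (j := j) (by omega) (by omega) h

theorem left_of_mem_arc {i j : Fin m} {d : D} (hd : d ∈ T.arc i j) : G.left d = T.inf := by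
  obtain ⟨n, _, rfl⟩ := List.mem_map.1 hd
  exact T.left_iterate n

theorem right_of_rev_mem_arc {i j : Fin m} {d : D} (hd : G.rev d ∈ T.arc i j) :
    G.right d = T.inf :=
  T.left_of_mem_arc hd

theorem arc_subset {i j k l : Fin m} (hki : k ≤ i) (hij : i ≤ j) (hjl : j ≤ l) {d : D}
    (hd : d ∈ T.arc i j) : d ∈ T.arc k l := by
  rw [T.mem_arc (hki.trans (hij.trans hjl))]
  obtain ⟨n, h1, h2, h3⟩ := (T.mem_arc hij).1 hd
  exact ⟨n, (T.posS_mono hki).trans h1, h2.trans_le (T.posT_mono hjl), h3⟩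

theorem arc_isPath {i j : Fin m} (hij : i ≤ j) : G.IsPath (T.s i) (T.arc i j) (T.t j) := by
  have h := isPath_of_chain (G := G) (g := fun n => G.facePerm^[n] T.base)
    (fun n => by rw [Function.iterate_succ_apply', tail_facePerm]) (T.posS i)
    (T.posT j - T.posS i)
  rwa [show T.posS i + (T.posT j - T.posS i) = T.posT j by
    have := T.posS_lt_posT_of_le hij; omega] at h

variable {T} in
/-- The vertices residually reachable from a source after `s_i` are not on `P`. -/
theorem exists_closed_avoiding {c' f : D → ℝ} (hc' : ∀ d, 0 ≤ c' d) {i j k : Fin m}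
    (hf : G.IsMaxFlow c' {T.s i} {T.t j} f) (hblock : G.Blocked c' (T.s k) (T.t j)) {P : List D}
    (hP : G.IsPath (T.s i) P (T.t j)) (hPf : ∀ d ∈ P, 0 < f d) :
    ∃ A, G.IsClosedUnder (residualCap c' f) A ∧ T.s k ∈ A ∧ ∀ v, G.OnPath P v → v ∉ A := by
  obtain ⟨A, hA, hk, hj⟩ := hblock
  refine ⟨A, hf.isClosedUnder_residualCap hc' hA fun h => absurd h hj, hk, fun v hv hvA => hj ?_⟩
  exact hA.mem_of_onPath hP (fun d hd => (hPf d hd).trans_le (hf.1.2.1 d)) hv hvA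

variable [DecidableEq D]

theorem exists_winding_arc {i j : Fin m} (hij : i ≤ j) {P : List D}
    (hP : G.IsSimplePath (T.s i) P (T.t j)) :
    ∃ w, G.IsWinding T.inf (T.arc i j ++ G.revPath P) w ∧ ∀ x, 0 ≤ w x ∧ w x ≤ 1 := by
  obtain ⟨w, hw⟩ := exists_winding T.inf ((T.arc_isPath hij).append hP.1.revPath)
  exact ⟨w, hw, hw.nonneg_and_le_one (fun _ h => T.left_of_mem_arc h) (T.arc_nodup hij) hP⟩

variable {T}

theorem faceLeftOf_iff {i j : Fin m} {P : List D} {w : G.Face → ℤ}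
    (hw : G.IsWinding T.inf (T.arc i j ++ G.revPath P) w) {x : G.Face} :
    T.FaceLeftOf i j P x ↔ 0 < w x :=
  ⟨fun ⟨_, hw', h⟩ => hw.unique hw' ▸ h, fun h => ⟨w, hw, h⟩⟩

/-! ### Residual paths from sources before `s_i` -/

/-- A face left of `P` is left of every residual path `Z` that starts at or before `s_i` and ends at
or after `t_j`: otherwise there is a clockwise residual cycle in `Z ∪ rev P`. -/
theorem winding_pos_of_winding_pos {i j k l : Fin m} (hki : k ≤ i) (hij : i ≤ j) (hjl : j ≤ l)
    {r : D → ℝ} (hr : G.CwAcyclic T.inf r) {P Z : List D} (hPr : ∀ d ∈ P, 0 < r (G.rev d))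
    (hZr : Residual r Z) {w w' : G.Face → ℤ}
    (hw : G.IsWinding T.inf (T.arc i j ++ G.revPath P) w)
    (hw' : G.IsWinding T.inf (T.arc k l ++ G.revPath Z) w') (hb' : ∀ x, 0 ≤ w' x)
    (x : G.Face) (hx : 0 < w x) : 0 < w' x := by
  by_contra! hx'
  obtain ⟨C, hC, hCcw, hCM⟩ := exists_clockwise_boundary_cycle (inf := T.inf)
    (M := {x | 0 < w x ∧ w' x ≤ 0}) (fun h => h.1.ne' hw.1) ⟨x, hx, hx'⟩
  refine hr C hC hCcw fun d hd => ?_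
  obtain ⟨h1, h2⟩ := hCM d hd
  simp only [Set.mem_ofPred_eq, not_and, not_le] at h1 h2
  -- A boundary dart outside `Z` and the reverse of `P` does not lower `w'`, so its left face also
  -- has `w' ≤ 0`, hence `w ≤ 0`. Then `w` rises across it, so it lies on the inner arc, thus on the
  -- outer one, and `w'` rises to at least one.
  by_contra hneg
  have hdZ : d ∉ Z := fun h => hneg (hZr d h)
  have hdP : G.rev d ∉ P := fun h => hneg (by simpa using hPr _ h)
  have hdA : G.rev d ∉ T.arc k l := fun h => h2.1.ne' (T.right_of_rev_mem_arc h ▸ hw.1)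
  have e := hw.diff_eq d
  have e' := hw'.diff_eq d
  have hl := hb' (G.left d)
  rw [List.count_eq_zero_of_not_mem hdP] at e
  rw [List.count_eq_zero_of_not_mem hdA, List.count_eq_zero_of_not_mem hdZ] at e'
  by_cases hd' : d ∈ T.arc i j
  · have := List.count_pos_iff.2 (T.arc_subset hki hij hjl hd')
    omega
  · rw [List.count_eq_zero_of_not_mem hd'] at e
    omega

/-- Off the boundary arc, a dart of `Z` has winding zero of `w'` on its right, so its right face is
not left of `P`; being off `P`, neither is its left face. The remaining cases concern edges on the
arcs, next to the infinite face. -/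
theorem not_strictlyLeftOf_of_source_le {i j k l : Fin m} (hki : k ≤ i) (hij : i ≤ j)
    (hjl : j ≤ l) {r : D → ℝ} (hr : G.CwAcyclic T.inf r) {P Z : List D}
    (hP : G.IsSimplePath (T.s i) P (T.t j)) (hPr : ∀ d ∈ P, 0 < r (G.rev d))
    (hZ : G.IsSimplePath (T.s k) Z (T.t l)) (hZr : Residual r Z) {d : D} (hd : d ∈ Z) :
    ¬ T.StrictlyLeftOf i j P d := by
  obtain ⟨w, hw, hb⟩ := T.exists_winding_arc hij hP
  obtain ⟨w', hw', hb'⟩ := T.exists_winding_arc (hki.trans (hij.trans hjl)) hZ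
  have hww' := winding_pos_of_winding_pos hki hij hjl hr hPr hZr hw hw' fun x => (hb' x).1
  rintro ⟨hor, hdP, hrP⟩
  rw [faceLeftOf_iff hw, faceLeftOf_iff hw] at hor
  have e := hw.diff_eq d
  have e' := hw'.diff_eq d
  rw [List.count_eq_zero_of_not_mem hdP, List.count_eq_zero_of_not_mem hrP,
    (T.arc_nodup hij).count, (T.arc_nodup hij).count] at e
  rw [List.count_eq_zero_of_not_mem (hZ.rev_notMem hd), List.count_eq_one_of_mem hZ.nodup hd,
    (T.arc_nodup (hki.trans (hij.trans hjl))).count,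
    (T.arc_nodup (hki.trans (hij.trans hjl))).count] at e'
  have hsub : ∀ e, e ∈ T.arc i j → e ∈ T.arc k l := fun e h => T.arc_subset hki hij hjl h
  have h0 := hw.1
  have h0' := hw'.1
  have bl := hb' (G.left d)
  have br := hb' (G.right d)
  have cl := hww' (G.left d)
  have cr := hww' (G.right d)
  by_cases ha : d ∈ T.arc k l
  · rw [T.left_of_mem_arc ha] at *
    by_cases ha' : G.rev d ∈ T.arc k l
    · rw [T.right_of_rev_mem_arc ha'] at *
      simp only [ha, ha', if_true] at e'
      omega
    · have hra : G.rev d ∉ T.arc i j := fun h => ha' (hsub _ h)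
      simp only [ha, ha', if_true, if_false] at e'
      simp only [hra, if_false] at e
      by_cases hda : d ∈ T.arc i j
      · simp only [hda, if_true] at e
        omega
      · simp only [hda, hra, or_false] at hor
        omega
  · have hda : d ∉ T.arc i j := fun h => ha (hsub _ h)
    by_cases ha' : G.rev d ∈ T.arc k l
    · rw [T.right_of_rev_mem_arc ha'] at *
      simp only [ha, ha', if_true, if_false] at e'
      omega
    · have hra : G.rev d ∉ T.arc i j := fun h => ha' (hsub _ h)
      simp only [ha, ha', if_false] at e'
      simp only [hda, hra, if_false] at e
      simp only [hda, hra, or_false] at hor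
      omega

/-! ### Paths that avoid `P` -/

theorem StrictlyLeftOf.rev {i j : Fin m} {P : List D} {d : D} (h : T.StrictlyLeftOf i j P d) :
    T.StrictlyLeftOf i j P (G.rev d) := by
  obtain ⟨h1, h2, h3⟩ := h
  refine ⟨?_, h3, by rwa [rev_rev_apply]⟩
  rw [left_rev, right_rev, rev_rev_apply]
  tauto

/-- If the right face of `d` is enclosed, it is the left face of `rot d`. Otherwise `rev d` lies on
the arc, and `rot d` is the next boundary dart. -/
theorem StrictlyLeftOf.rot {i j : Fin m} (hij : i ≤ j) {P : List D}
    (hP : G.IsSimplePath (T.s i) P (T.t j)) {d : D} (h : T.StrictlyLeftOf i j P d)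
    (hd : ¬ G.OnPath P (G.tail d)) : T.StrictlyLeftOf i j P (G.rot d) := by
  obtain ⟨w, hw, hb⟩ := T.exists_winding_arc hij hP
  obtain ⟨hor, hdP, hrP⟩ := h
  refine ⟨?_, fun h => hd ⟨_, h, Or.inl (by simp)⟩, fun h => hd ⟨_, h, Or.inr (by simp)⟩⟩
  rw [faceLeftOf_iff hw, faceLeftOf_iff hw] at *
  rw [left_rot]
  by_cases hr : 0 < w (G.right d)
  · exact Or.inl hr
  have e := hw.diff_eq d
  rw [List.count_eq_zero_of_not_mem hdP, List.count_eq_zero_of_not_mem hrP] at e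
  have hrev : G.rev d ∈ T.arc i j := by
    by_contra hra
    rw [List.count_eq_zero_of_not_mem hra] at e
    simp only [hra, or_false] at hor
    have hl := (hb (G.left d)).1
    rcases hor with h | h | h
    · omega
    · exact hr h
    · have := List.count_pos_iff.2 h
      omega
  obtain ⟨n, h1, h2, h3⟩ := (T.mem_arc hij).1 hrev
  have h4 : G.facePerm^[n + 1] T.base = G.rot d := by
    rw [Function.iterate_succ_apply', h3, facePerm_rev]
  refine Or.inr (Or.inr (Or.inl ((T.mem_arc hij).2 ⟨n + 1, by omega, ?_, h4⟩)))
  -- The arc can stop at this vertex only if it is $t_j$, which lies on `P`.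
  by_contra hn
  have hne : P ≠ [] := by
    rintro rfl
    exact T.s_ne_t i j hP.1
  refine hd ?_
  rw [← tail_rot, ← h4, show n + 1 = T.posT j by omega]
  exact hP.1.onPath_end hne

theorem StrictlyLeftOf.of_tail_eq {i j : Fin m} (hij : i ≤ j) {P : List D}
    (hP : G.IsSimplePath (T.s i) P (T.t j)) {d e : D} (h : T.StrictlyLeftOf i j P d)
    (hd : ¬ G.OnPath P (G.tail d)) (hde : G.tail d = G.tail e) : T.StrictlyLeftOf i j P e := by
  have hcyc : G.rot.SameCycle d e := Quotient.exact hde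
  obtain ⟨n, -, rfl⟩ := hcyc.exists_pow_eq'
  clear hde hcyc
  induction n with
  | zero => exact h
  | succ n ih =>
    have htail : ∀ n, G.tail ((G.rot ^ n) d) = G.tail d := by
      intro n
      induction n with
      | zero => rfl
      | succ n ih => rw [pow_succ', Equiv.Perm.mul_apply, tail_rot, ih]
    rw [pow_succ', Equiv.Perm.mul_apply]
    exact ih.rot hij hP (by rwa [htail])

theorem strictlyLeftOf_of_path {i j : Fin m} (hij : i ≤ j) {P : List D}
    (hP : G.IsSimplePath (T.s i) P (T.t j)) {u v : G.Vertex} {Z : List D} (hZ : G.IsPath u Z v)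
    (hZP : ∀ x ∈ u :: Z.map G.head, ¬ G.OnPath P x)
    (hu : ∀ e, G.tail e = u → T.StrictlyLeftOf i j P e) {e : D} (he : G.tail e = v) :
    T.StrictlyLeftOf i j P e := by
  induction Z generalizing u with
  | nil => exact hu e (he.trans hZ.symm)
  | cons d Z ih =>
    refine ih hZ.2 (fun x hx => hZP x (List.mem_cons_of_mem _ hx)) fun e he => ?_
    exact (hu d hZ.1).rev.of_tail_eq hij hP (hZP _ (by simp)) he.symm

theorem strictlyLeftOf_of_mem_path {i j : Fin m} (hij : i ≤ j) {P : List D}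
    (hP : G.IsSimplePath (T.s i) P (T.t j)) {u v : G.Vertex} {Z : List D} (hZ : G.IsPath u Z v)
    (hZP : ∀ x ∈ u :: Z.map G.head, ¬ G.OnPath P x) {d : D} (hd : d ∈ Z)
    (h : T.StrictlyLeftOf i j P d) {e : D} (he : G.tail e = v) :
    T.StrictlyLeftOf i j P e := by
  induction Z generalizing u with
  | nil => simp at hd
  | cons d' Z ih =>
    rcases List.mem_cons.1 hd with rfl | hd
    · exact strictlyLeftOf_of_path hij hP hZ hZP
        (fun e he => h.of_tail_eq hij hP (hZP _ (by simp [hZ.1])) (hZ.1.trans he.symm)) he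
    · exact ih hZ.2 (fun x hx => hZP x (List.mem_cons_of_mem _ hx)) hd

/-- This boundary dart at $t_l$ comes after the arc and has winding zero on its left. Crossing it
cannot raise the winding, and if its reverse were on the arc, the winding would become negative. -/
theorem not_strictlyLeftOf_later_sink {i j l : Fin m} (hij : i ≤ j) (hjl : j < l) {P : List D}
    (hP : G.IsSimplePath (T.s i) P (T.t j)) :
    ¬ T.StrictlyLeftOf i j P (G.facePerm^[T.posT l] T.base) := by
  obtain ⟨w, hw, hb⟩ := T.exists_winding_arc hij hP
  rintro ⟨hor, hdP, hrP⟩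
  rw [faceLeftOf_iff hw, faceLeftOf_iff hw] at hor
  set d := G.facePerm^[T.posT l] T.base with hd
  have hda : d ∉ T.arc i j := by
    intro h
    obtain ⟨n, -, h2, h3⟩ := (T.mem_arc hij).1 h
    have := T.iterate_inj h2.le le_rfl (h3.trans hd)
    have := T.posT_strictMono hjl
    omega
  have e := hw.diff_eq d
  rw [List.count_eq_zero_of_not_mem hdP, List.count_eq_zero_of_not_mem hrP,
    List.count_eq_zero_of_not_mem hda, T.left_iterate, hw.1] at e
  rw [T.left_iterate, hw.1] at hor
  have hr := (hb (G.right d)).1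
  rcases hor with h | h | h | h
  · exact lt_irrefl _ h
  · omega
  · exact hda h
  · have := List.count_pos_iff.2 h
    omega

/-- Around vertices off `P`, being strictly left passes to all darts, so it would travel along `Z`
to the boundary dart at $t_l$. -/
theorem not_strictlyLeftOf_of_avoids {i j l : Fin m} (hij : i ≤ j) (hjl : j < l) {P Z : List D}
    (hP : G.IsSimplePath (T.s i) P (T.t j)) {u : G.Vertex} (hZ : G.IsPath u Z (T.t l))
    (hZP : ∀ x ∈ u :: Z.map G.head, ¬ G.OnPath P x) {d : D} (hd : d ∈ Z) :
    ¬ T.StrictlyLeftOf i j P d := fun h =>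
  not_strictlyLeftOf_later_sink hij hjl hP (strictlyLeftOf_of_mem_path hij hP hZ hZP hd h rfl)

/-! ### Deletion -/

/-- Darts that lie on no simple residual path from a source to a sink can be deleted. -/
theorem exists_flow_deleteCap {c : D → ℝ} (hc : ∀ d, 0 ≤ c d) {X : Set D}
    (hX : ∀ k l Z, G.IsSimplePath (T.s k) Z (T.t l) → Residual c Z → ∀ d ∈ Z, d ∉ X) {g : D → ℝ}
    (hg : G.IsFlow c (Set.range T.s ∪ Set.range T.t) g) :
    ∃ g', G.IsFlow (deleteCap c X) (Set.range T.s ∪ Set.range T.t) g' ∧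
      G.flowValue (Set.range T.t) g ≤ G.flowValue (Set.range T.t) g' := by
  rw [isFlow_iff] at hg
  obtain ⟨g', h1, h2, h3, h4, h5⟩ := exists_path_flow T.disjoint_range hg.1 hg.2.2
  refine ⟨g', G.isFlow_iff.2 ⟨h1, fun d => ?_, h2⟩, h4⟩
  rw [deleteCap]
  split_ifs with hd
  · by_contra! hpos
    obtain ⟨_, ⟨k, rfl⟩, _, ⟨l, rfl⟩, Z, hZ, hdZ, hres⟩ := h5 d hpos
    exact hX k l Z hZ (fun e he => (hres e he).trans_le (hg.2.1 e)) d hdZ hd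
  · exact (h3 d).trans (max_le (hg.2.1 d) (hc d))

end Terminals

end

end PlaneGraph

/-! ### Proof of the theorem -/

open PlaneGraph in
theorem PlaneGraph.IsPathDecomposition.pos_of_mem {D : Type*} [Fintype D] [DecidableEq D]
    {G : PlaneGraph D} {inf : G.Face} {s t : G.Vertex} {f : D → ℝ} {Ps : List (List D × ℝ)}
    (h : G.IsPathDecomposition inf s t f Ps) {p : List D × ℝ} (hp : p ∈ Ps) {d : D}
    (hd : d ∈ p.1) : 0 < f d := by
  classical
  have h1 := h.sum d
  have h2 : p.2 ≤ (Ps.map fun p => if d ∈ p.1 then p.2 else 0).sum := by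
    refine le_trans (by rw [if_pos hd]) (List.single_le_sum (l := Ps.map fun p =>
      if d ∈ p.1 then p.2 else 0) ?_ _ (List.mem_map_of_mem hp))
    intro x hx
    obtain ⟨q, hq, rfl⟩ := List.mem_map.1 hx
    split_ifs
    · exact (h.pos q hq).le
    · exact le_rfl
  have h3 := h.pos p hp
  by_contra! hneg
  rw [max_eq_right hneg] at h1
  have h4 : (0 : ℝ) = (Ps.map fun p => if d ∈ p.1 then p.2 else 0).sum := by convert h1
  linarith

theorem mainTheorem4 {D : Type*} [Fintype D] [DecidableEq D] (G : PlaneGraph D)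
    {m : ℕ} (T : G.Terminals m)
    (c : D → ℝ) (hc : ∀ d, 0 ≤ c d)
    (c₀ : D → ℝ) (hc₀ : T.Preprocessed c c₀)
    -- the iterations before and after iteration `(i, j)`
    (before after : List (Fin m × Fin m)) (i j : Fin m)
    (hij : iterations m = before ++ (i, j) :: after)
    -- the capacities at the start of iteration `(i, j)` and the flow found in it
    (c' : D → ℝ) (hrun : T.Run before c₀ c')
    (f : D → ℝ) (hf : G.IsLeftmostMaxFlow T.inf c' (T.s i) (T.t j) f)
    -- the rightmost path `P` of its decomposition
    (Ps : List (List D × ℝ)) (hPs : G.IsPathDecomposition T.inf (T.s i) (T.t j) f Ps)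
    (P : List D) (a : ℝ) (hP : Ps.getLast? = some (P, a)) :
    (∀ k, i < k → ∀ v, G.OnPath P v → ∀ Q, G.IsPath (T.s k) Q v →
      ¬ PlaneGraph.Residual (PlaneGraph.residualCap c' f) Q) ∧
    (∀ X : Set D, (∀ d ∈ X, T.StrictlyLeftOf i j P d) →
      -- deletion of `X` does not decrease the flow value that can still be sent
      (∀ g, G.IsFlow (PlaneGraph.residualCap c' f) (Set.range T.s ∪ Set.range T.t) g →
        ∃ g', G.IsFlow (PlaneGraph.deleteCap (PlaneGraph.residualCap c' f) X)
            (Set.range T.s ∪ Set.range T.t) g' ∧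
          G.flowValue (Set.range T.t) g ≤ G.flowValue (Set.range T.t) g') ∧
      -- the remaining iterations, run after deletion of `X`, complete a maximum flow
      (∀ cEnd, T.Run after (PlaneGraph.deleteCap (PlaneGraph.residualCap c' f) X) cEnd →
        G.IsMaxFlow c (Set.range T.s) (Set.range T.t) fun d =>
          (c d - PlaneGraph.residualCap c' f d) +
            (PlaneGraph.deleteCap (PlaneGraph.residualCap c' f) X d - cEnd d))) := by
  classical
  open PlaneGraph PlaneGraph.Terminals in
  have hle : i ≤ j := mem_iterations.1 (show (i, j) ∈ iterations m by simp [hij])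
  obtain ⟨⟨f₀, hf₀, rfl⟩, hpre, -⟩ := hc₀
  have hc' := hrun.nonneg hf₀.residualCap_nonneg
  have hr := hf.1.1.residualCap_nonneg
  -- The invariant starts with the pairs $l<k$, which the preprocessing blocks.
  have hblock : T.BlockedPairs c' before := by
    have := hrun.blockedPairs (b := []) (a := (i, j) :: after) hij hf₀.residualCap_nonneg
      fun k l h => blocked_of_forall_not_residual fun p hp =>
        hpre l k (h.resolve_right (by simp)) p hp
    simpa using this
  have hblock' := hblock.step hc' hij hf.1
  have hmem : (P, a) ∈ Ps := List.mem_of_getLast? hP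
  have hPsimple : G.IsSimplePath (T.s i) P (T.t j) := hPs.simple _ hmem
  have hPf : ∀ d ∈ P, 0 < f d := fun d hd => hPs.pos_of_mem hmem hd
  have hPr : ∀ d ∈ P, 0 < residualCap c' f (G.rev d) := fun d hd => by
    have h1 := hPf d hd
    have h2 := hc' (G.rev d)
    rw [residualCap, hf.1.1.1]
    linarith
  have hsource : ∀ k, i < k → ∃ A, G.IsClosedUnder (residualCap c' f) A ∧ T.s k ∈ A ∧
      ∀ v, G.OnPath P v → v ∉ A := fun k hk =>
    exists_closed_avoiding hc' hf.1
      (hblock k j (by rw [mem_before_iff hij]; omega)) hPsimple.1 hPf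
  refine ⟨fun k hk v hv Q hQ hres => ?_, fun X hX => ?_⟩
  · obtain ⟨A, hA, hkA, hPA⟩ := hsource k hk
    exact hPA v hv (hA.mem_of_path hQ hres hkA)
  have hpath : ∀ k l Z, G.IsSimplePath (T.s k) Z (T.t l) → Residual (residualCap c' f) Z →
      ∀ d ∈ Z, d ∉ X := by
    intro k l Z hZ hZr d hd hdX
    -- Being unblocked, the pair comes later in the order: $k\le l$, and $l>j$ or $l=j$ with $k<i$.
    have hkl : ¬ (l < k ∨ (k, l) ∈ before ++ [(i, j)]) := fun h =>
      (hblock' k l h).not_residual hZ.1 hZr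
    rw [List.mem_append, mem_before_iff hij, List.mem_singleton, Prod.mk.injEq] at hkl
    refine absurd (hX d hdX) ?_
    by_cases hik : i < k
    · obtain ⟨A, hA, hkA, hPA⟩ := hsource k hik
      exact not_strictlyLeftOf_of_avoids hle (l := l) (by omega) hPsimple hZ.1
        (fun x hx hxP => hPA x hxP (hA.forall_mem hZ.1 hZr hkA x hx)) hd
    · exact not_strictlyLeftOf_of_source_le (not_lt.1 hik) hle (by omega) hf.2 hPsimple hPr hZ hZr
        hd
  have hdel : ∀ g, G.IsFlow (residualCap c' f) (Set.range T.s ∪ Set.range T.t) g →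
      ∃ g', G.IsFlow (deleteCap (residualCap c' f) X) (Set.range T.s ∪ Set.range T.t) g' ∧
        G.flowValue (Set.range T.t) g ≤ G.flowValue (Set.range T.t) g' :=
    fun g hg => exists_flow_deleteCap hr hpath hg
  refine ⟨hdel, fun cEnd hend => ?_⟩
  have hflow : G.IsFlow c (Set.range T.s ∪ Set.range T.t) (c - residualCap c' f) := by
    have h1 := hrun.isFlow hf₀.residualCap_nonneg
    have h2 := h1.add (g := f) (by
      rw [residualCap_sub_self]
      exact isFlow_of_isLeftmostMaxFlow hf)
    have h3 := hf₀.add h2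
    convert h3 using 1
    ext d
    simp only [residualCap, Pi.add_apply, Pi.sub_apply]
    ring
  have hr' := deleteCap_nonneg hr X
  -- Lowering capacities keeps closed sets closed, so the invariant runs on from the deleted
  -- capacities until all pairs are blocked.
  have hmax : G.IsMaxFlow (deleteCap (residualCap c' f) X) (Set.range T.s) (Set.range T.t)
      (deleteCap (residualCap c' f) X - cEnd) := by
    refine isMaxFlow_of_blocked (hend.isFlow hr') ?_
    rintro _ ⟨k, rfl⟩ _ ⟨l, rfl⟩
    rw [residualCap_sub_self]
    refine hend.blockedPairs (b := before ++ [(i, j)]) (a := []) (by simpa using hij) hr'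
      (fun k l h => (hblock' k l h).mono fun d hd => (deleteCap_le hr X d).trans hd) k l ?_
    rw [List.append_assoc, List.singleton_append, ← hij, mem_iterations]
    exact lt_or_ge l k
  have hrest : G.IsFlow (residualCap c (c - residualCap c' f)) (Set.range T.s ∪ Set.range T.t)
      (deleteCap (residualCap c' f) X - cEnd) := by
    rw [residualCap_sub_self]
    exact ⟨hmax.1.1, fun d => (hmax.1.2.1 d).trans (deleteCap_le hr X d), hmax.1.2.2⟩
  change G.IsMaxFlow c _ _ ((c - residualCap c' f) + (deleteCap (residualCap c' f) X - cEnd))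
  refine ⟨hflow.add hrest, fun g hg => ?_⟩
  -- The part of a competitor `g` beyond the flow already sent is residual, so it can be moved off
  -- `X` and compared with the later iterations.
  obtain ⟨g', hg', hval⟩ := hdel _ (hg.sub hflow)
  have h1 := hmax.2 g' hg'
  rw [← add_sub_cancel (c - residualCap c' f) g, flowValue_add, flowValue_add]
  linarith
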